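/- Let $\ell,T>0$, let $m,\mu,r\in L^\infty(0,\ell)$ with $m(x)\ge m_0>0$, $\mu(x)\ge 0$ and $r(x)\ge r_0>0$ for a.e. $x\in(0,\ell)$, let $k_r^-,k_a^-,k_r^+,k_a^+\ge 0$, and let $u_0\in H^2(0,\ell)$, $u_1\in L^2(0,\ell)$. Put $\mathcal V^2=\{v\in H^2(0,\ell): v(0)=v(\ell)=0\}$ and consider $$m u_{tt}+\mu u_t+(r u_{xx})_{xx}=0 \ \text{ in }(0,\ell)\times(0,T),\qquad u(\cdot,0)=u_0,\quad u_t(\cdot,0)=u_1,$$ $$u(0,t)=u(\ell,t)=0,\quad (-ru_{xx})(0,t)=-k_r^-u_x(0,t)-k_a^-u_{xt}(0,t),\quad (-ru_{xx})(\ell,t)=k_r^+u_x(\ell,t)+k_a^+u_{xt}(\ell,t).$$ A weak solution is a function $u\in L^2(0,T;\mathcal V^2)$ with $u_t\in L^2(0,T;L^2(0,\ell))$ and $(m u_t)_t\in L^2(0,T;(\mathcal V^2)')$, with $u(\cdot,0)=u_0$ and $m u_t(\cdot,0)=m u_1$, such that for all $v\in\mathcal V^2$, in the sense of distributions in $t\in(0,T)$,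 $$\langle (m u_t)_t,v\rangle+\int_0^\ell(\mu u_t v+r u_{xx}v'')\,dx+\big(k_r^-u_x(0,t)+k_a^-\tfrac{d}{dt}u_x(0,t)\big)v'(0)+\big(k_r^+u_x(\ell,t)+k_a^+\tfrac{d}{dt}u_x(\ell,t)\big)v'(\ell)=0 .$$ Let $u$ be a weak solution. Then, after modification on a null set of times, $u\in C([0,T];\mathcal V^2)\cap C^1([0,T];L^2(0,\ell))$ with $u(\cdot,0)=u_0$ and $u_t(\cdot,0)=u_1$; if $k_a^->0$ then $u_x(0,\cdot)$ has a weak derivative $u_{xt}(0,\cdot)\in L^2(0,T)$, and if $k_a^+>0$ then $u_x(\ell,\cdot)$ has a weak derivative $u_{xt}(\ell,\cdot)\in L^2(0,T)$; and for every $t\in[0,T]$ $$\mathcal E(t)+\int_0^t\!\int_0^\ell\mu(x)u_\tau^2(x,\tau)\,dx\,d\tau=\mathcal E(0)-k_a^-\int_0^t u_{x\tau}^2(0,\tau)\,d\tau-k_a^+\int_0^t u_{x\tau}^2(\ell,\tau)\,d\tau,$$ where a term with $k_a^\pm=0$ is read as $0$, $$\mathcal E(t)=\frac12\int_0^\ell\big[m(x)u_t^2(x,t)+r(x)u_{xx}^2(x,t)\big]dx+\frac12k_r^-u_x^2(0,t)+\frac12k_r^+u_x^2(\ell,t),$$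 $$\mathcal E(0)=\frac12\int_0^\ell\big[m(x)u_1(x)^2+r(x)u_0''(x)^2\big]dx+\frac12k_r^-u_0'(0)^2+\frac12k_r^+u_0'(\ell)^2 .$$ Consequently $\mathcal E$ is nonincreasing on $[0,T]$ and $\mathcal E(t)\le\mathcal E(0)$ for all $t\in[0,T]$. -/

import Mathlib

open MeasureTheory Set Filter Topology
open scoped ContDiff

noncomputable section

namespace BeamEnergy

/-- Test functions: smooth functions on the line with compact support inside the open set `S`. -/
structure IsTest (S : Set ℝ) (φ : ℝ → ℝ) : Prop where
  smooth : ContDiff ℝ ∞ φ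
  compact : HasCompactSupport φ
  supp : tsupport φ ⊆ S

/-- `g` is the weak (distributional) derivative of `f` on the interval `(a, b)`. -/
def HasWeakDeriv {E : Type*} [NormedAddCommGroup E] [NormedSpace ℝ E]
    (a b : ℝ) (f g : ℝ → E) : Prop :=
  ∀ φ : ℝ → ℝ, IsTest (Ioo a b) φ →
    ∫ s in Ioo a b, deriv φ s • f s = -∫ s in Ioo a b, φ s • g s

/-- The Lebesgue space `L²(0, ℓ)`. -/
abbrev L2 (ℓ : ℝ) : Type := Lp ℝ 2 (volume.restrict (Ioo (0 : ℝ) ℓ))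

lemma L2.integrable_smul {ℓ : ℝ} (f : L2 ℓ) {ψ : ℝ → ℝ} (hψ : Continuous ψ)
    (hc : HasCompactSupport ψ) :
    Integrable (fun s => ψ s • f s) (volume.restrict (Ioo (0 : ℝ) ℓ)) := by
  obtain ⟨C, hC⟩ := hc.exists_bound_of_continuous hψ
  have hf : Integrable (f : ℝ → ℝ) (volume.restrict (Ioo (0 : ℝ) ℓ)) :=
    (Lp.memLp f).integrable (by norm_num)
  exact hf.bdd_smul C hψ.aestronglyMeasurable (Eventually.of_forall hC)

lemma HasWeakDeriv.L2_add {ℓ : ℝ} {f g f' g' : L2 ℓ} (h : HasWeakDeriv 0 ℓ f f')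
    (k : HasWeakDeriv 0 ℓ g g') : HasWeakDeriv 0 ℓ (f + g : L2 ℓ) (f' + g' : L2 ℓ) := by
  intro φ hφ
  have hd : Continuous (deriv φ) := hφ.smooth.continuous_deriv (by simp)
  have e1 : ∫ s in Ioo 0 ℓ, deriv φ s • (f + g : L2 ℓ) s
      = ∫ s in Ioo 0 ℓ, (deriv φ s • f s + deriv φ s • g s) := by
    refine integral_congr_ae ?_
    filter_upwards [Lp.coeFn_add f g] with s hs
    rw [hs, Pi.add_apply, smul_add]
  have e2 : ∫ s in Ioo 0 ℓ, φ s • (f' + g' : L2 ℓ) s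
      = ∫ s in Ioo 0 ℓ, (φ s • f' s + φ s • g' s) := by
    refine integral_congr_ae ?_
    filter_upwards [Lp.coeFn_add f' g'] with s hs
    rw [hs, Pi.add_apply, smul_add]
  rw [e1, e2, integral_add (L2.integrable_smul f hd hφ.compact.deriv)
    (L2.integrable_smul g hd hφ.compact.deriv),
    integral_add (L2.integrable_smul f' hφ.smooth.continuous hφ.compact)
    (L2.integrable_smul g' hφ.smooth.continuous hφ.compact), h φ hφ, k φ hφ]
  ring

lemma HasWeakDeriv.L2_smul {ℓ : ℝ} {f f' : L2 ℓ} (c : ℝ) (h : HasWeakDeriv 0 ℓ f f') :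
    HasWeakDeriv 0 ℓ (c • f : L2 ℓ) (c • f' : L2 ℓ) := by
  intro φ hφ
  have e1 : ∫ s in Ioo 0 ℓ, deriv φ s • (c • f : L2 ℓ) s
      = ∫ s in Ioo 0 ℓ, c * (deriv φ s • f s) := by
    refine integral_congr_ae ?_
    filter_upwards [Lp.coeFn_smul c f] with s hs
    rw [hs, Pi.smul_apply]
    simp only [smul_eq_mul]
    ring
  have e2 : ∫ s in Ioo 0 ℓ, φ s • (c • f' : L2 ℓ) s
      = ∫ s in Ioo 0 ℓ, c * (φ s • f' s) := by
    refine integral_congr_ae ?_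
    filter_upwards [Lp.coeFn_smul c f'] with s hs
    rw [hs, Pi.smul_apply]
    simp only [smul_eq_mul]
    ring
  rw [e1, e2, integral_const_mul, integral_const_mul, h φ hφ]
  ring

lemma HasWeakDeriv.L2_zero {ℓ : ℝ} : HasWeakDeriv 0 ℓ (0 : L2 ℓ) (0 : L2 ℓ) := by
  intro φ hφ
  have e : ∀ ψ : ℝ → ℝ, ∫ s in Ioo 0 ℓ, ψ s • (0 : L2 ℓ) s = 0 := by
    intro ψ
    refine integral_eq_zero_of_ae ?_
    filter_upwards [Lp.coeFn_zero ℝ 2 (volume.restrict (Ioo 0 ℓ))] with s hs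
    rw [hs]
    simp
  rw [e, e, neg_zero]

/-- Triples `(v, v', v'')` of elements of `L²(0, ℓ)`, with the norm `max (‖v‖, ‖v'‖, ‖v''‖)`. -/
abbrev Jet (ℓ : ℝ) : Type := L2 ℓ × L2 ℓ × L2 ℓ

/-- The first entry `v` of a triple. -/
def fn {ℓ : ℝ} (v : Jet ℓ) : L2 ℓ := v.1

/-- The second entry of a triple; the weak derivative `v'` when the triple is in `H²`. -/
def d1 {ℓ : ℝ} (v : Jet ℓ) : L2 ℓ := v.2.1

/-- The third entry of a triple; the second weak derivative `v''` when the triple is in `H²`. -/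
def d2 {ℓ : ℝ} (v : Jet ℓ) : L2 ℓ := v.2.2

/-- The Sobolev space `H²(0, ℓ)`: triples `(v, v', v'')` in `L²(0, ℓ)` in which each entry is the
weak derivative of the preceding one (so `v` determines the triple), with the norm
`max (‖v‖, ‖v'‖, ‖v''‖)`, which is equivalent to the usual Hilbert norm. -/
def H2 (ℓ : ℝ) : Submodule ℝ (Jet ℓ) where
  carrier := {v | HasWeakDeriv 0 ℓ (fn v) (d1 v) ∧ HasWeakDeriv 0 ℓ (d1 v) (d2 v)}
  add_mem' := fun ha hb => ⟨ha.1.L2_add hb.1, ha.2.L2_add hb.2⟩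
  zero_mem' := ⟨HasWeakDeriv.L2_zero, HasWeakDeriv.L2_zero⟩
  smul_mem' := fun c _ h => ⟨h.1.L2_smul c, h.2.L2_smul c⟩

/-- `F` is a representative of `f ∈ L²(0, ℓ)` which is continuous on the closed interval
`[0, ℓ]`; for `ℓ > 0` its restriction to `[0, ℓ]` is unique. -/
def IsContRep {ℓ : ℝ} (f : L2 ℓ) (F : ℝ → ℝ) : Prop :=
  ContinuousOn F (Icc 0 ℓ) ∧ f =ᵐ[volume.restrict (Ioo (0 : ℝ) ℓ)] F

open Classical in
/-- The value at `a ∈ [0, ℓ]` of the continuous representative of `f` (which exists whenever `f`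
has a weak derivative in `L²(0, ℓ)`, in particular for `f = v` and `f = v'` with `v ∈ H²`). -/
def value {ℓ : ℝ} (f : L2 ℓ) (a : ℝ) : ℝ :=
  if h : ∃ F, IsContRep f F then h.choose a else 0

/-- The space `𝒱²(0, ℓ) = {v ∈ H²(0, ℓ) : v(0) = v(ℓ) = 0}`. -/
def V2 (ℓ : ℝ) : Submodule ℝ (Jet ℓ) where
  carrier := {v | v ∈ H2 ℓ ∧ ∃ F, IsContRep (fn v) F ∧ F 0 = 0 ∧ F ℓ = 0}
  add_mem' := by
    rintro a b ⟨ha, F, hF, hF0, hFl⟩ ⟨hb, G, hG, hG0, hGl⟩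
    refine ⟨(H2 ℓ).add_mem ha hb, F + G, ⟨hF.1.add hG.1, ?_⟩, by simp [hF0, hG0],
      by simp [hFl, hGl]⟩
    exact (Lp.coeFn_add (fn a) (fn b)).trans (hF.2.add hG.2)
  zero_mem' :=
    ⟨(H2 ℓ).zero_mem, 0, ⟨continuousOn_const, Lp.coeFn_zero ℝ 2 (volume.restrict (Ioo 0 ℓ))⟩,
      rfl, rfl⟩
  smul_mem' := by
    rintro c a ⟨ha, F, hF, hF0, hFl⟩
    refine ⟨(H2 ℓ).smul_mem c ha, c • F, ⟨hF.1.const_smul c, ?_⟩, by simp [hF0], by simp [hFl]⟩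
    exact (Lp.coeFn_smul c (fn a)).trans (hF.2.const_smul c)

/-- The data of the beam problem: length, final time, coefficients `m`, `μ`, `r`, and the
stiffnesses of the torsional springs (`kr`) and dampers (`ka`) at the left and right ends. -/
structure Beam where
  ℓ : ℝ
  T : ℝ
  m : ℝ → ℝ
  μ : ℝ → ℝ
  r : ℝ → ℝ
  krL : ℝ
  kaL : ℝ
  krR : ℝ
  kaR : ℝ

/-- The basic conditions on the data (the conditions `u₀ ∈ H²` and `u₁ ∈ L²` are carried by the
types of `u₀` and `u₁`). -/
structure Beam.Basic (B : Beam) : Prop where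
  ℓ_pos : 0 < B.ℓ
  T_pos : 0 < B.T
  m_Linfty : MemLp B.m ⊤ (volume.restrict (Ioo 0 B.ℓ))
  μ_Linfty : MemLp B.μ ⊤ (volume.restrict (Ioo 0 B.ℓ))
  r_Linfty : MemLp B.r ⊤ (volume.restrict (Ioo 0 B.ℓ))
  m_bound : ∃ m₀ > 0, ∀ᵐ x ∂(volume.restrict (Ioo 0 B.ℓ)), m₀ ≤ B.m x
  μ_nonneg : ∀ᵐ x ∂(volume.restrict (Ioo 0 B.ℓ)), 0 ≤ B.μ x
  r_bound : ∃ r₀ > 0, ∀ᵐ x ∂(volume.restrict (Ioo 0 B.ℓ)), r₀ ≤ B.r x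
  krL_nonneg : 0 ≤ B.krL
  kaL_nonneg : 0 ≤ B.kaL
  krR_nonneg : 0 ≤ B.krR
  kaR_nonneg : 0 ≤ B.kaR

/-- `u ∈ L²(0, T; 𝒱²)` is a weak solution of the initial boundary value problem
`m u_tt + μ u_t + (r u_xx)_xx = 0`, `u(0, t) = u(ℓ, t) = 0`,
`r u_xx = krL u_x + kaL u_xt` at `x = 0`, `-r u_xx = krR u_x + kaR u_xt` at `x = ℓ`,
`u(·, 0) = u₀`, `u_t(·, 0) = u₁`. Here `ut` is `u_t` and `w` is `(m u_t)_t`. -/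
structure IsWeakSolution (B : Beam) (u₀ : H2 B.ℓ) (u₁ : L2 B.ℓ) (u : ℝ → V2 B.ℓ)
    (ut : ℝ → L2 B.ℓ) (w : ℝ → (V2 B.ℓ →L[ℝ] ℝ)) : Prop where
  /-- `u ∈ L²(0, T; 𝒱²)` -/
  memLp_u : MemLp u 2 (volume.restrict (Ioo 0 B.T))
  /-- `u_t ∈ L²(0, T; L²(0, ℓ))` -/
  memLp_ut : MemLp ut 2 (volume.restrict (Ioo 0 B.T))
  /-- `(m u_t)_t ∈ L²(0, T; (𝒱²)')` -/
  memLp_w : MemLp w 2 (volume.restrict (Ioo 0 B.T))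
  /-- `ut` is the time derivative of `u`, and `u(·, 0) = u₀`: integration by parts in time against
  test functions on `(-∞, T)`. -/
  deriv_u : ∀ φ : ℝ → ℝ, IsTest (Iio B.T) φ →
    ∫ t in Ioo 0 B.T, deriv φ t • fn (u t : Jet B.ℓ)
      = -(∫ t in Ioo 0 B.T, φ t • ut t) - φ 0 • fn (u₀ : Jet B.ℓ)
  /-- `w` is the time derivative of `m u_t`, and `m u_t(·, 0) = m u₁`. -/
  deriv_ut : ∀ (v : V2 B.ℓ) (φ : ℝ → ℝ), IsTest (Iio B.T) φ →
    ∫ t in Ioo 0 B.T, deriv φ t * ∫ x in Ioo 0 B.ℓ, B.m x * ut t x * fn (v : Jet B.ℓ) x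
      = -(∫ t in Ioo 0 B.T, φ t * w t v)
        - φ 0 * ∫ x in Ioo 0 B.ℓ, B.m x * u₁ x * fn (v : Jet B.ℓ) x
  /-- The weak form of the equation and of the boundary conditions on the moment, in the sense of
  distributions in time on `(0, T)`; the derivative in `u_xt` is thrown on `φ`. -/
  equation : ∀ (v : V2 B.ℓ) (φ : ℝ → ℝ), IsTest (Ioo 0 B.T) φ →
    (∫ t in Ioo 0 B.T, φ t *
        (w t v
          + (∫ x in Ioo 0 B.ℓ, B.μ x * ut t x * fn (v : Jet B.ℓ) x)
          + (∫ x in Ioo 0 B.ℓ, B.r x * d2 (u t : Jet B.ℓ) x * d2 (v : Jet B.ℓ) x)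
          + B.krL * value (d1 (u t : Jet B.ℓ)) 0 * value (d1 (v : Jet B.ℓ)) 0
          + B.krR * value (d1 (u t : Jet B.ℓ)) B.ℓ * value (d1 (v : Jet B.ℓ)) B.ℓ))
      - (∫ t in Ioo 0 B.T, deriv φ t *
        (B.kaL * value (d1 (u t : Jet B.ℓ)) 0 * value (d1 (v : Jet B.ℓ)) 0
          + B.kaR * value (d1 (u t : Jet B.ℓ)) B.ℓ * value (d1 (v : Jet B.ℓ)) B.ℓ))
      = 0

/-- The total energy of the state with deflection `y` (in `H²`, given as a triple `(y, y', y'')`)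
and velocity `z`. -/
def energy (B : Beam) (y : Jet B.ℓ) (z : L2 B.ℓ) : ℝ :=
  (1 / 2) * (∫ x in Ioo 0 B.ℓ, (B.m x * (z x) ^ 2 + B.r x * (d2 y x) ^ 2))
    + (1 / 2) * B.krL * (value (d1 y) 0) ^ 2
    + (1 / 2) * B.krR * (value (d1 y) B.ℓ) ^ 2

end BeamEnergy

end

/-! Formally, the identity comes from testing the equation with `u_t`. For a weak solution this is
not allowed: `u_t(t)` lies only in `L²`, while `(m u_t)_t` lies only in the dual of `𝒱²`. The remedy
is to mollify in time. All forms are independent of time, so a mollified weak solution satisfies the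
same linear equation and is smooth in time with values in `𝒱²`; its energy balance is then the
fundamental theorem of calculus (`SmoothSolution.energy_sub`).

Differences of mollifications are again solutions. Comparing the energy at `t` with the energy at
`s` and averaging over `s` bounds the energy norm at every time by the `L²` norm in time
(`SmoothSolution.norm_sq_le`). Hence mollifications that converge in `L²` converge uniformly in the
energy norm. This gives the continuous representatives and carries the energy balance to the limit
(`exists_continuous_limit`). One-sided kernels, looking forward near `0` and backward near `T`,
reach both ends of the time interval, and the two pieces are glued on the middle third.

The dampers need a preliminary step. The equation contains the slopes at the ends only through
distributional time derivatives. Testing it with elements of `𝒱²` whose end slopes are `(1, 0)` and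
`(0, 1)` isolates each damper and expresses the derivative of `k_a^± u_x` through terms in `L²(0,
T)`. The state that is mollified is therefore the triple of `u`, `u_t` and these slope rates.

The beam fits the abstract scheme because traces of slopes are continuous on `𝒱²`, `𝒱²` is complete,
and its norm is controlled by `‖v''‖` (Rolle and a Poincaré inequality). The springs are absorbed in
the stiffness form. The initial data are recovered by testing in time against bumps that shrink to
`t = 0`. -/

noncomputable section

namespace BeamEnergy

/-! ### Mollification in `L²` of the line with values in a Banach space -/

section Mollify

open scoped ENNReal Convolution

variable {E : Type*} [NormedAddCommGroup E]

lemma eLpNorm_two_sq {α : Type*} [MeasurableSpace α] {F : Type*} [NormedAddCommGroup F]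
    (μ : Measure α) (f : α → F) :
    eLpNorm f 2 μ ^ (2 : ℝ) = ∫⁻ x, ‖f x‖ₑ ^ (2 : ℝ) ∂μ := by
  rw [eLpNorm_eq_lintegral_rpow_enorm_toReal (by norm_num) (by norm_num), ENNReal.toReal_ofNat,
    ← ENNReal.rpow_mul]
  norm_num

/-- Translation is continuous in `L²(ℝ; E)`. -/
lemma tendsto_eLpNorm_translate_sub {f : ℝ → E} (hf : MemLp f 2 volume) :
    Tendsto (fun σ : ℝ => eLpNorm (fun t => f (t - σ) - f t) 2 volume) (𝓝 0) (𝓝 0) := by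
  set F := hf.toLp f
  -- Translation is the action of the domain on `Lp`, which is continuous for a finite exponent. The
  -- sign makes the action by `-σ` evaluate at `t - σ`.
  have hcont : Continuous fun σ : ℝ => (DomAddAct.mk (-σ)) +ᵥ F := by
    have h : Continuous fun σ : ℝ => (DomAddAct.mk (-σ) : ℝᵈᵃᵃ) :=
      DomAddAct.continuous_mk.comp continuous_neg
    have : Fact ((2 : ℝ≥0∞) ≠ ⊤) := ⟨by norm_num⟩
    exact h.vadd continuous_const
  have h0 := hcont.edist (continuous_const (y := F))
  have h1 := h0.tendsto 0
  have e0 : edist ((DomAddAct.mk (-(0 : ℝ))) +ᵥ F) F = 0 := by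
    rw [neg_zero]
    have : (DomAddAct.mk (0 : ℝ)) +ᵥ F = F := zero_vadd (ℝᵈᵃᵃ) F
    rw [this, edist_self]
  rw [e0] at h1
  refine h1.congr fun σ => ?_
  rw [Lp.edist_def]
  refine eLpNorm_congr_ae ?_
  have h2 := DomAddAct.vadd_Lp_ae_eq (DomAddAct.mk (-σ) : ℝᵈᵃᵃ) F
  have h3 : F =ᵐ[volume] f := hf.coeFn_toLp
  have h4 := (measurePreserving_sub_right volume σ).quasiMeasurePreserving.ae_eq_comp h3
  filter_upwards [h2, h3, h4] with t a b c
  simp only [Pi.sub_apply, a, b]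
  simp only [Function.comp_def] at c
  rw [← c]
  simp [sub_eq_neg_add]

/-- Jensen's inequality for the square: Hölder against the constant `1`, which has norm one for a
probability measure. -/
lemma lintegral_rpow_two_le {P : Measure ℝ} [IsProbabilityMeasure P] {g : ℝ → ℝ≥0∞}
    (hg : AEMeasurable g P) : (∫⁻ x, g x ∂P) ^ (2 : ℝ) ≤ ∫⁻ x, g x ^ (2 : ℝ) ∂P := by
  have h := ENNReal.lintegral_mul_le_Lp_mul_Lq P (p := 2) (q := 2)
    ⟨by norm_num, by norm_num, by norm_num⟩ (f := fun _ => 1) (g := g) aemeasurable_const hg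
  simp only [Pi.mul_apply, one_mul, ENNReal.one_rpow, lintegral_const, measure_univ,
    mul_one] at h
  calc (∫⁻ x, g x ∂P) ^ (2 : ℝ) ≤ ((∫⁻ x, g x ^ (2 : ℝ) ∂P) ^ ((1 : ℝ) / 2)) ^ (2 : ℝ) :=
        ENNReal.rpow_le_rpow h (by norm_num)
    _ = _ := by rw [← ENNReal.rpow_mul]; norm_num

/-- Mollifying changes a function in `L²` by at most the largest translation error over the support
of the kernel. -/
lemma eLpNorm_convolution_sub_le [NormedSpace ℝ E] [CompleteSpace E] {f : ℝ → E}
    (hf : MemLp f 2 volume) {κ : ℝ → ℝ}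
    (hκ : Continuous κ) (hc : HasCompactSupport κ) (hpos : ∀ x, 0 ≤ κ x) (h1 : ∫ x, κ x = 1)
    {δ : ℝ≥0∞}
    (hδ : ∀ σ ∈ Function.support κ, eLpNorm (fun t => f (t - σ) - f t) 2 volume ≤ δ) :
    eLpNorm (fun t => (κ ⋆[ContinuousLinearMap.lsmul ℝ ℝ, volume] f) t - f t) 2 volume ≤ δ := by
  -- Taking the kernel as a probability measure makes the error an average of translation errors.
  -- Jensen and Tonelli then reduce the claim to the bound `δ` on each translation.
  set P : Measure ℝ := volume.withDensity fun x => ENNReal.ofReal (κ x) with hP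
  have hκi : Integrable κ := hκ.integrable_of_hasCompactSupport hc
  have hκm : Measurable fun x => ENNReal.ofReal (κ x) := hκ.measurable.ennreal_ofReal
  have hPp : IsProbabilityMeasure P := by
    refine ⟨?_⟩
    rw [hP, withDensity_apply _ MeasurableSet.univ, Measure.restrict_univ,
      ← ofReal_integral_eq_lintegral_ofReal hκi (Eventually.of_forall hpos), h1,
      ENNReal.ofReal_one]
  have hPac : P ≪ volume := withDensity_absolutelyContinuous _ _
  have hmeas : AEStronglyMeasurable (fun z : ℝ × ℝ => f (z.1 - z.2) - f z.1)
      (volume.prod volume) :=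
    (hf.1.comp_quasiMeasurePreserving (quasiMeasurePreserving_sub volume volume)).sub
      hf.1.comp_fst
  have hmeasP : AEStronglyMeasurable (fun z : ℝ × ℝ => f (z.1 - z.2) - f z.1)
      (volume.prod P) :=
    hmeas.mono_ac (Measure.AbsolutelyContinuous.prod Measure.AbsolutelyContinuous.rfl hPac)
  have hloc : LocallyIntegrable f := hf.locallyIntegrable (by norm_num)
  have key : ∀ t, ‖(κ ⋆[ContinuousLinearMap.lsmul ℝ ℝ, volume] f) t - f t‖ₑ
      ≤ ∫⁻ σ, ‖f (t - σ) - f t‖ₑ ∂P := by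
    intro t
    have hint : Integrable fun σ => κ σ • f (t - σ) :=
      hc.convolutionExists_left (ContinuousLinearMap.lsmul ℝ ℝ) hκ hloc t
    have e : (κ ⋆[ContinuousLinearMap.lsmul ℝ ℝ, volume] f) t - f t
        = ∫ σ, κ σ • (f (t - σ) - f t) := by
      simp only [smul_sub]
      rw [integral_sub hint (hκi.smul_const _), integral_smul_const, h1, one_smul]
      rfl
    rw [e]
    refine (enorm_integral_le_lintegral_enorm _).trans ?_
    rw [hP, lintegral_withDensity_eq_lintegral_mul_non_measurable _ hκm
      (Eventually.of_forall fun _ => ENNReal.ofReal_lt_top)]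
    refine lintegral_mono fun σ => ?_
    simp only [Pi.mul_apply, enorm_smul]
    rw [Real.enorm_eq_ofReal (hpos σ)]
  rw [← ENNReal.rpow_le_rpow_iff (z := 2) (by norm_num), eLpNorm_two_sq]
  have hsec : ∀ᵐ t : ℝ, AEMeasurable (fun σ => ‖f (t - σ) - f t‖ₑ) P := by
    filter_upwards [hmeasP.prodMk_left] with t ht using ht.enorm
  calc ∫⁻ t, ‖(κ ⋆[ContinuousLinearMap.lsmul ℝ ℝ, volume] f) t - f t‖ₑ ^ (2 : ℝ)
      ≤ ∫⁻ t, (∫⁻ σ, ‖f (t - σ) - f t‖ₑ ^ (2 : ℝ) ∂P) ∂volume := by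
        refine lintegral_mono_ae ?_
        filter_upwards [hsec] with t ht
        exact (ENNReal.rpow_le_rpow (key t) (by norm_num)).trans (lintegral_rpow_two_le ht)
    _ = ∫⁻ σ, (∫⁻ t, ‖f (t - σ) - f t‖ₑ ^ (2 : ℝ)) ∂P := by
        exact lintegral_lintegral_swap (f := fun t σ => ‖f (t - σ) - f t‖ₑ ^ (2 : ℝ))
          (hmeasP.enorm.pow_const _)
    _ ≤ ∫⁻ _, δ ^ (2 : ℝ) ∂P := by
        refine lintegral_mono_ae ?_
        have hs : ∀ᵐ σ ∂P, σ ∈ Function.support κ := by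
          rw [hP, ae_withDensity_iff hκm]
          refine Eventually.of_forall fun σ h h0 => h ?_
          simp [h0]
        filter_upwards [hs] with σ hσ
        rw [← eLpNorm_two_sq]
        exact ENNReal.rpow_le_rpow (hδ σ hσ) (by norm_num)
    _ = δ ^ (2 : ℝ) := by simp

/-- Mollification with kernels concentrating at the origin converges in `L²(ℝ; E)`. -/
lemma tendsto_eLpNorm_convolution_sub [NormedSpace ℝ E] [CompleteSpace E] {f : ℝ → E}
    (hf : MemLp f 2 volume)
    {κ : ℕ → ℝ → ℝ} (hκ : ∀ n, Continuous (κ n)) (hc : ∀ n, HasCompactSupport (κ n))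
    (hpos : ∀ n x, 0 ≤ κ n x) (h1 : ∀ n, ∫ x, κ n x = 1)
    (hsupp : Tendsto (fun n => Function.support (κ n)) atTop (𝓝 0).smallSets) :
    Tendsto (fun n => eLpNorm
      (fun t => (κ n ⋆[ContinuousLinearMap.lsmul ℝ ℝ, volume] f) t - f t) 2 volume)
      atTop (𝓝 0) := by
  rw [ENNReal.tendsto_nhds_zero]
  intro δ hδ
  have h := (ENNReal.tendsto_nhds_zero.1 (tendsto_eLpNorm_translate_sub hf)) δ hδ
  filter_upwards [hsupp.eventually (eventually_smallSets_forall.2 h)] with n hn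
  exact eLpNorm_convolution_sub_le hf (hκ n) (hc n) (hpos n) (h1 n) hn

end Mollify

/-! ### Passage to the limit in integrals of bilinear expressions -/

section BilinearLimit

open scoped ENNReal

variable {α E F G : Type*} [MeasurableSpace α] {μ : Measure α}
  [NormedAddCommGroup E] [NormedAddCommGroup F] [NormedAddCommGroup G]

lemma integral_norm_sq_eq {g : α → E} (hg : MemLp g 2 μ) :
    ∫ x, ‖g x‖ ^ 2 ∂μ = (eLpNorm g 2 μ).toReal ^ 2 := by
  rw [hg.eLpNorm_eq_integral_rpow_norm (by norm_num) (by norm_num), ENNReal.toReal_ofReal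
    (by positivity), ENNReal.toReal_ofNat, ← Real.rpow_natCast _ 2, ← Real.rpow_mul
    (integral_nonneg fun x => by positivity)]
  norm_num

variable [NormedSpace ℝ E] [NormedSpace ℝ F] [NormedSpace ℝ G]

lemma MemLp.integrable_bilin {f : α → E} {g : α → F} (B : E →L[ℝ] F →L[ℝ] G)
    (hf : MemLp f 2 μ) (hg : MemLp g 2 μ) : Integrable (fun x => B (f x) (g x)) μ :=
  memLp_one_iff_integrable.1 (B.memLp_of_bilin 1 hf hg)

/-- The integral is a jointly continuous pairing of the two `L²` classes, so strong convergence of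
both factors suffices. -/
lemma tendsto_integral_bilin [CompleteSpace G] (B : E →L[ℝ] F →L[ℝ] G)
    {f : ℕ → α → E} {f₀ : α → E} {g : ℕ → α → F} {g₀ : α → F}
    (hf : ∀ n, MemLp (f n) 2 μ) (hf₀ : MemLp f₀ 2 μ) (hg : ∀ n, MemLp (g n) 2 μ)
    (hg₀ : MemLp g₀ 2 μ)
    (hfl : Tendsto (fun n => eLpNorm (fun x => f n x - f₀ x) 2 μ) atTop (𝓝 0))
    (hgl : Tendsto (fun n => eLpNorm (fun x => g n x - g₀ x) 2 μ) atTop (𝓝 0)) :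
    Tendsto (fun n => ∫ x, B (f n x) (g n x) ∂μ) atTop (𝓝 (∫ x, B (f₀ x) (g₀ x) ∂μ)) := by
  have key : ∀ {f : α → E} {g : α → F} (hf : MemLp f 2 μ) (hg : MemLp g 2 μ),
      B.lpPairing μ 2 2 (hf.toLp f) (hg.toLp g) = ∫ x, B (f x) (g x) ∂μ := by
    intro f g hf hg
    rw [ContinuousLinearMap.lpPairing_eq_integral]
    refine integral_congr_ae ?_
    filter_upwards [hf.coeFn_toLp, hg.coeFn_toLp] with x h1 h2
    rw [h1, h2]
  have h1 : Tendsto (fun n => (hf n).toLp (f n)) atTop (𝓝 (hf₀.toLp f₀)) :=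
    (Lp.tendsto_Lp_iff_tendsto_eLpNorm'' f hf f₀ hf₀).2 hfl
  have h2 : Tendsto (fun n => (hg n).toLp (g n)) atTop (𝓝 (hg₀.toLp g₀)) :=
    (Lp.tendsto_Lp_iff_tendsto_eLpNorm'' g hg g₀ hg₀).2 hgl
  have h3 := (B.lpPairing μ 2 2).continuous₂.tendsto (hf₀.toLp f₀, hg₀.toLp g₀)
  have h4 := h3.comp (h1.prodMk_nhds h2)
  simpa only [Function.comp_def, Function.uncurry, key] using h4

end BilinearLimit

/-! ### Abstract damped waves: energy balance and a priori bound for smooth solutions -/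

/-- Abstract data of a damped wave equation: the inclusion `i` of the energy space, the mass form
`M`, the viscous damping form `N`, the stiffness form `a`, and damping `k j` acting through the
functionals `b j`. -/
structure DampedWave (V H : Type*) [NormedAddCommGroup V] [NormedSpace ℝ V]
    [NormedAddCommGroup H] [NormedSpace ℝ H] where
  i : V →L[ℝ] H
  M : H →L[ℝ] H →L[ℝ] ℝ
  N : H →L[ℝ] H →L[ℝ] ℝ
  a : V →L[ℝ] V →L[ℝ] ℝ
  b : Fin 2 → V →L[ℝ] ℝ
  k : Fin 2 → ℝ

/-- Position, velocity, and the time derivatives of the damped functionals. -/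
abbrev State (V H : Type*) : Type _ := V × H × (Fin 2 → ℝ)

namespace DampedWave

variable {V H : Type*} [NormedAddCommGroup V] [NormedSpace ℝ V]
  [NormedAddCommGroup H] [NormedSpace ℝ H] (S : DampedWave V H)

/-- The coordinate projection to the velocity. -/
def velocity : State V H →L[ℝ] H :=
  (ContinuousLinearMap.fst ℝ H (Fin 2 → ℝ)).comp (ContinuousLinearMap.snd ℝ V _)

/-- The coordinate projection to the `j`-th damped functional. -/
def damper (j : Fin 2) : State V H →L[ℝ] ℝ :=
  (ContinuousLinearMap.proj j).comp
    ((ContinuousLinearMap.snd ℝ H (Fin 2 → ℝ)).comp (ContinuousLinearMap.snd ℝ V _))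

set_option synthInstance.maxHeartbeats 200000 in
/-- The polarised energy. -/
def energyForm : State V H →L[ℝ] State V H →L[ℝ] ℝ :=
  (1 / 2 : ℝ) • (S.M.bilinearComp velocity velocity
    + S.a.bilinearComp (ContinuousLinearMap.fst ℝ V _) (ContinuousLinearMap.fst ℝ V _))

set_option synthInstance.maxHeartbeats 200000 in
/-- The polarised rate of dissipation. -/
def dissipation : State V H →L[ℝ] State V H →L[ℝ] ℝ :=
  S.N.bilinearComp velocity velocity
    + ∑ j, S.k j • (ContinuousLinearMap.mul ℝ ℝ).bilinearComp (damper j) (damper j)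

set_option synthInstance.maxHeartbeats 200000 in
lemma energyForm_apply (x y : State V H) :
    S.energyForm x y = 1 / 2 * (S.M x.2.1 y.2.1 + S.a x.1 y.1) := by
  simp [energyForm, velocity]
  ring

set_option synthInstance.maxHeartbeats 200000 in
lemma dissipation_apply (x y : State V H) :
    S.dissipation x y = S.N x.2.1 y.2.1 + ∑ j, S.k j * (x.2.2 j * y.2.2 j) := by
  simp [dissipation, velocity, damper]

/-- The mass and stiffness forms are symmetric and coercive. -/
structure Coercive (c : ℝ) : Prop where
  pos : 0 < c
  M_symm : ∀ x y, S.M x y = S.M y x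
  a_symm : ∀ x y, S.a x y = S.a y x
  M_le : ∀ x, c * ‖x‖ ^ 2 ≤ S.M x x
  a_le : ∀ x, c * ‖x‖ ^ 2 ≤ S.a x x

/-- `x'` is an admissible time derivative at the state `x`. -/
structure Balanced (x x' : State V H) : Prop where
  velocity_eq : S.i x'.1 = x.2.1
  damper_eq : ∀ j, S.k j * S.b j x'.1 = S.k j * x.2.2 j
  equation : ∀ z, S.M x'.2.1 (S.i z) + S.N x.2.1 (S.i z) + S.a x.1 z
    + ∑ j, S.k j * S.b j x'.1 * S.b j z = 0

/-- `F` is a smooth solution on `[α, β]` with derivative `F'`. -/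
structure SmoothSolution (α β : ℝ) (F F' : ℝ → State V H) : Prop where
  hasDerivAt : ∀ t, HasDerivAt F (F' t) t
  continuous_deriv : Continuous F'
  balanced : ∀ t ∈ Icc α β, S.Balanced (F t) (F' t)

variable {S} {α β : ℝ}

/-- All three conditions are linear. This lets the energy estimate be applied to the difference of
two mollifications, which gives the Cauchy property. -/
lemma Balanced.sub {x x' y y' : State V H} (h : S.Balanced x x') (g : S.Balanced y y') :
    S.Balanced (x - y) (x' - y') where
  velocity_eq := by simp [h.velocity_eq, g.velocity_eq]
  damper_eq j := by
    have h1 := h.damper_eq j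
    have h2 := g.damper_eq j
    simp only [Prod.fst_sub, Prod.snd_sub, Pi.sub_apply, map_sub, mul_sub, h1, h2]
  equation z := by
    have h1 := h.equation z
    have h2 := g.equation z
    simp only [Fin.sum_univ_two] at h1 h2 ⊢
    simp only [Prod.fst_sub, Prod.snd_sub, map_sub, sub_apply]
    linarith

lemma SmoothSolution.sub {F F' G G' : ℝ → State V H} (h : S.SmoothSolution α β F F')
    (g : S.SmoothSolution α β G G') : S.SmoothSolution α β (F - G) (F' - G') where
  hasDerivAt t := (h.hasDerivAt t).sub (g.hasDerivAt t)
  continuous_deriv := h.continuous_deriv.sub g.continuous_deriv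
  balanced t ht := (h.balanced t ht).sub (g.balanced t ht)

lemma SmoothSolution.continuous {F F' : ℝ → State V H} (h : S.SmoothSolution α β F F') :
    Continuous F :=
  continuous_iff_continuousAt.2 fun t => (h.hasDerivAt t).continuousAt

/-- The equation is tested with `z = x'.1`, which is admissible because the derivative of the
position lies in `V`. Its image in `H` is the velocity, so symmetry of the mass and stiffness forms
turns those terms into the derivative of the energy. -/
lemma Balanced.two_energyForm {c : ℝ} (hS : S.Coercive c) {x x' : State V H}
    (h : S.Balanced x x') :
    S.energyForm x x' + S.energyForm x' x = -S.dissipation x x := by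
  have h1 := h.equation x'.1
  have h2 := h.damper_eq 0
  have h3 := h.damper_eq 1
  rw [energyForm_apply, energyForm_apply, dissipation_apply, hS.M_symm x.2.1, hS.a_symm x'.1]
  rw [h.velocity_eq] at h1
  simp only [Fin.sum_univ_two] at h1 ⊢
  -- Only the products with `k j` are known to agree, so the two factors `b j x'.1` are replaced one
  -- at a time, each time using the factor `k j`. This also covers `k j = 0`.
  have e : ∀ j, S.k j * S.b j x'.1 = S.k j * x.2.2 j →
      S.k j * S.b j x'.1 * S.b j x'.1 = S.k j * (x.2.2 j * x.2.2 j) := fun j hj => by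
    rw [hj]; linear_combination x.2.2 j * hj
  rw [e 0 h2, e 1 h3] at h1
  linarith

lemma SmoothSolution.energy_sub {c : ℝ} (hS : S.Coercive c) {F F' : ℝ → State V H}
    (h : S.SmoothSolution α β F F') {s t : ℝ} (hs : s ∈ Icc α β) (ht : t ∈ Icc α β) :
    S.energyForm (F t) (F t) - S.energyForm (F s) (F s)
      = -∫ τ in s..t, S.dissipation (F τ) (F τ) := by
  rw [← intervalIntegral.integral_neg]
  symm
  refine intervalIntegral.integral_eq_sub_of_hasDerivAt
    (f := fun τ => S.energyForm (F τ) (F τ)) (fun τ hτ => ?_) ?_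
  · have hτ' : τ ∈ Icc α β := uIcc_subset_Icc hs ht hτ
    rw [← (h.balanced τ hτ').two_energyForm hS]
    exact S.energyForm.hasDerivAt_of_bilinear (fun _ => h.hasDerivAt τ) fun _ => h.hasDerivAt τ
  · have := h.continuous
    exact Continuous.intervalIntegrable (by fun_prop) _ _

lemma SmoothSolution.position_sub [CompleteSpace H] {F F' : ℝ → State V H}
    (h : S.SmoothSolution α β F F') {s t : ℝ} (hs : s ∈ Icc α β) (ht : t ∈ Icc α β) :
    S.i (F t).1 - S.i (F s).1 = ∫ τ in s..t, (F τ).2.1 := by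
  symm
  refine intervalIntegral.integral_eq_sub_of_hasDerivAt
    (f := fun τ => S.i (F τ).1) (fun τ hτ => ?_) ?_
  · have hτ' : τ ∈ Icc α β := uIcc_subset_Icc hs ht hτ
    rw [← (h.balanced τ hτ').velocity_eq]
    exact (S.i.comp (ContinuousLinearMap.fst ℝ V (H × (Fin 2 → ℝ)))).hasFDerivAt.comp_hasDerivAt τ
      (h.hasDerivAt τ)
  · have := h.continuous
    exact Continuous.intervalIntegrable (by fun_prop) _ _

lemma Coercive.norm_sq_le {c : ℝ} (hS : S.Coercive c) (x : State V H) :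
    c / 2 * ‖(x.1, x.2.1)‖ ^ 2 ≤ S.energyForm x x := by
  rw [energyForm_apply]
  have h1 := hS.M_le x.2.1
  have h2 := hS.a_le x.1
  have hc := hS.pos
  have p1 : 0 ≤ c * ‖x.2.1‖ ^ 2 := by positivity
  have p2 : 0 ≤ c * ‖x.1‖ ^ 2 := by positivity
  rw [Prod.norm_mk]
  rcases max_cases ‖x.1‖ ‖x.2.1‖ with h | h <;> rw [h.1] <;> linarith

lemma abs_apply_self_le {E : Type*} [NormedAddCommGroup E] [NormedSpace ℝ E]
    (B : E →L[ℝ] E →L[ℝ] ℝ) (x : E) : |B x x| ≤ ‖B‖ * ‖x‖ ^ 2 := by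
  simpa [pow_two, mul_assoc] using B.le_opNorm₂ x x

/-- The energy of a smooth solution is controlled uniformly by its `L²` norm in time. -/
lemma SmoothSolution.norm_sq_le {c : ℝ} (hS : S.Coercive c) (hαβ : α < β)
    {F F' : ℝ → State V H} (h : S.SmoothSolution α β F F') {t : ℝ} (ht : t ∈ Icc α β) :
    (β - α) * (c / 2) * ‖((F t).1, (F t).2.1)‖ ^ 2
      ≤ (‖S.energyForm‖ + (β - α) * ‖S.dissipation‖) * ∫ τ in α..β, ‖F τ‖ ^ 2 := by
  have hF := h.continuous
  have hI : ∀ s t, IntervalIntegrable (fun τ => ‖F τ‖ ^ 2) volume s t := fun s t =>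
    Continuous.intervalIntegrable (by fun_prop) _ _
  set K := ∫ τ in α..β, ‖F τ‖ ^ 2 with hK
  have hD : ∀ s ∈ Icc α β, |∫ τ in s..t, S.dissipation (F τ) (F τ)| ≤ ‖S.dissipation‖ * K := by
    intro s hs
    have h1 : |∫ τ in s..t, S.dissipation (F τ) (F τ)|
        ≤ |∫ τ in s..t, ‖S.dissipation‖ * ‖F τ‖ ^ 2| := by
      rw [← Real.norm_eq_abs]
      exact intervalIntegral.norm_integral_le_abs_of_norm_le
        (Eventually.of_forall fun τ => abs_apply_self_le _ _) ((hI s t).const_mul _)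
    refine h1.trans ?_
    rw [intervalIntegral.integral_const_mul, abs_mul, abs_of_nonneg (norm_nonneg S.dissipation)]
    gcongr
    refine (intervalIntegral.abs_integral_mono_interval ?_ (Eventually.of_forall fun τ => ?_)
      (hI α β)).trans (le_of_eq (abs_of_nonneg ?_))
    · rw [uIoc_of_le hαβ.le]
      exact Ioc_subset_Ioc (le_min hs.1 ht.1) (max_le hs.2 ht.2)
    · simp only [Pi.zero_apply]; positivity
    · exact intervalIntegral.integral_nonneg hαβ.le fun τ _ => by positivity
  -- The energy at `t` is compared with the energy at an arbitrary `s`. Integrating over `s`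
  -- afterwards replaces the uncontrolled value at `s` by the `L²` norm in time.
  have hs : ∀ s ∈ Icc α β, c / 2 * ‖((F t).1, (F t).2.1)‖ ^ 2 - ‖S.dissipation‖ * K
      ≤ ‖S.energyForm‖ * ‖F s‖ ^ 2 := by
    intro s hs
    have h1 := h.energy_sub hS hs ht
    have h2 := hD s hs
    have h3 := hS.norm_sq_le (F t)
    have h4 := abs_apply_self_le S.energyForm (F s)
    have h5 := neg_abs_le (∫ τ in s..t, S.dissipation (F τ) (F τ))
    have h6 := le_abs_self (S.energyForm (F s) (F s))
    linarith
  have h7 := intervalIntegral.integral_mono_on hαβ.le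
    (intervalIntegrable_const (c := c / 2 * ‖((F t).1, (F t).2.1)‖ ^ 2 - ‖S.dissipation‖ * K))
    ((hI α β).const_mul _) hs
  rw [intervalIntegral.integral_const, intervalIntegral.integral_const_mul, smul_eq_mul] at h7
  linarith

end DampedWave

/-! ### Uniform limits of smooth solutions -/

namespace DampedWave

variable {V H : Type*} [NormedAddCommGroup V] [NormedSpace ℝ V]
  [NormedAddCommGroup H] [NormedSpace ℝ H] {S : DampedWave V H} {α β : ℝ}

lemma tendsto_setIntegral_bilin {E F G : Type*} [NormedAddCommGroup E] [NormedSpace ℝ E]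
    [NormedAddCommGroup F] [NormedSpace ℝ F]
    [NormedAddCommGroup G] [NormedSpace ℝ G] [CompleteSpace G] (B : E →L[ℝ] F →L[ℝ] G)
    {f : ℕ → ℝ → E} {f₀ : ℝ → E} {g : ℕ → ℝ → F} {g₀ : ℝ → F}
    (hf : ∀ n, MemLp (f n) 2 volume) (hf₀ : MemLp f₀ 2 volume)
    (hg : ∀ n, MemLp (g n) 2 volume) (hg₀ : MemLp g₀ 2 volume)
    (hfl : Tendsto (fun n => eLpNorm (fun x => f n x - f₀ x) 2 volume) atTop (𝓝 0))
    (hgl : Tendsto (fun n => eLpNorm (fun x => g n x - g₀ x) 2 volume) atTop (𝓝 0)) (s t : ℝ) :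
    Tendsto (fun n => ∫ x in s..t, B (f n x) (g n x)) atTop
      (𝓝 (∫ x in s..t, B (f₀ x) (g₀ x))) := by
  have key : ∀ A : Set ℝ, Tendsto (fun n => ∫ x in A, B (f n x) (g n x)) atTop
      (𝓝 (∫ x in A, B (f₀ x) (g₀ x))) := by
    intro A
    refine tendsto_integral_bilin B (fun n => (hf n).restrict A) (hf₀.restrict A)
      (fun n => (hg n).restrict A) (hg₀.restrict A) ?_ ?_
    · exact tendsto_of_tendsto_of_tendsto_of_le_of_le tendsto_const_nhds hfl (fun _ => zero_le)
        fun n => eLpNorm_mono_measure _ Measure.restrict_le_self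
    · exact tendsto_of_tendsto_of_tendsto_of_le_of_le tendsto_const_nhds hgl (fun _ => zero_le)
        fun n => eLpNorm_mono_measure _ Measure.restrict_le_self
  simp only [intervalIntegral]
  exact (key _).sub (key _)

/-- Smooth solutions which converge in `L²` converge uniformly in the energy norm; the energy
balance holds for the limit. -/
lemma exists_continuous_limit [CompleteSpace V] [CompleteSpace H] {c : ℝ} (hS : S.Coercive c)
    (hαβ : α < β) {F F' : ℕ → ℝ → State V H} {f : ℝ → State V H}
    (hF : ∀ n, S.SmoothSolution α β (F n) (F' n)) (hFL : ∀ n, MemLp (F n) 2 volume)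
    (hf : MemLp f 2 volume)
    (hlim : Tendsto (fun n => eLpNorm (fun t => F n t - f t) 2 volume) atTop (𝓝 0)) :
    ∃ W : ℝ → V × H, ContinuousOn W (Icc α β) ∧
      (∀ᵐ t, t ∈ Icc α β → W t = ((f t).1, (f t).2.1)) ∧
      (∀ s ∈ Icc α β, ∀ t ∈ Icc α β,
        S.energyForm ((W t).1, (W t).2, 0) ((W t).1, (W t).2, 0)
          - S.energyForm ((W s).1, (W s).2, 0) ((W s).1, (W s).2, 0)
        = -∫ τ in s..t, S.dissipation (f τ) (f τ)) ∧
      (∀ s ∈ Icc α β, ∀ t ∈ Icc α β, S.i (W t).1 - S.i (W s).1 = ∫ τ in s..t, (f τ).2.1) := by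
  set π : State V H → V × H := fun x => (x.1, x.2.1) with hπ
  set e : ℕ → ℝ := fun n => (eLpNorm (fun t => F n t - f t) 2 volume).toReal with he
  have hfin : ∀ n, eLpNorm (fun t => F n t - f t) 2 volume ≠ ⊤ := fun n =>
    ((hFL n).sub hf).eLpNorm_ne_top
  have he0 : Tendsto e atTop (𝓝 0) := by
    have := (ENNReal.tendsto_toReal ENNReal.zero_ne_top).comp hlim
    simpa [Function.comp_def] using this
  set A := (β - α) * (c / 2) with hA
  have hApos : 0 < A := mul_pos (sub_pos.2 hαβ) (half_pos hS.pos)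
  set K := ‖S.energyForm‖ + (β - α) * ‖S.dissipation‖ with hK
  have hK0 : 0 ≤ K := by
    have := sub_pos.2 hαβ
    have := norm_nonneg S.dissipation
    have := norm_nonneg S.energyForm
    positivity
  -- The a priori bound for `F n - F m`, combined with the triangle inequality through `f`, is
  -- uniform in `t`.
  have hdist : ∀ n m, ∀ t ∈ Icc α β,
      A * dist (π (F n t)) (π (F m t)) ^ 2 ≤ K * (e n + e m) ^ 2 := by
    intro n m t ht
    have h1 := ((hF n).sub (hF m)).norm_sq_le hS hαβ ht
    have h2 : ∫ τ in α..β, ‖(F n - F m) τ‖ ^ 2 ≤ (e n + e m) ^ 2 := by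
      have hm : MemLp (F n - F m) 2 volume := (hFL n).sub (hFL m)
      rw [intervalIntegral.integral_of_le hαβ.le, integral_norm_sq_eq (hm.restrict _)]
      refine pow_le_pow_left₀ ENNReal.toReal_nonneg ?_ 2
      rw [he, ← ENNReal.toReal_add (hfin n) (hfin m)]
      refine ENNReal.toReal_mono (ENNReal.add_ne_top.2 ⟨hfin n, hfin m⟩) ?_
      refine (eLpNorm_mono_measure _ Measure.restrict_le_self).trans ?_
      have h3 : F n - F m = (fun t => F n t - f t) - fun t => F m t - f t := by
        ext1 t; simp
      rw [h3]
      exact eLpNorm_sub_le ((hFL n).sub hf).1 ((hFL m).sub hf).1 (by norm_num)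
    have h3 : dist (π (F n t)) (π (F m t)) = ‖(((F n - F m) t).1, ((F n - F m) t).2.1)‖ := by
      rw [dist_eq_norm]; rfl
    rw [h3]
    exact h1.trans (mul_le_mul_of_nonneg_left h2 hK0)
  have hcauchy : UniformCauchySeqOn (fun n t => π (F n t)) atTop (Icc α β) := by
    rw [Metric.uniformCauchySeqOn_iff]
    intro ε hε
    have h1 : Tendsto (fun p : ℕ × ℕ => K * (e p.1 + e p.2) ^ 2) atTop (𝓝 0) := by
      have h2 : Tendsto (fun p : ℕ × ℕ => e p.1) atTop (𝓝 0) :=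
        he0.comp (by rw [← prod_atTop_atTop_eq]; exact tendsto_fst)
      have h3 : Tendsto (fun p : ℕ × ℕ => e p.2) atTop (𝓝 0) :=
        he0.comp (by rw [← prod_atTop_atTop_eq]; exact tendsto_snd)
      simpa using ((h2.add h3).pow 2).const_mul K
    have h2 : ∀ᶠ p : ℕ × ℕ in atTop, K * (e p.1 + e p.2) ^ 2 < A * ε ^ 2 :=
      h1.eventually_lt_const (by positivity)
    obtain ⟨N, hN⟩ := eventually_atTop.1 h2
    refine ⟨max N.1 N.2, fun m hm n hn t ht => ?_⟩
    have h3 := hN (m, n) ⟨(le_max_left _ _).trans hm, (le_max_right _ _).trans hn⟩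
    have h4 := lt_of_mul_lt_mul_left ((hdist m n t ht).trans_lt h3) hApos.le
    exact lt_of_pow_lt_pow_left₀ 2 hε.le h4
  have hex : ∀ t, ∃ y, t ∈ Icc α β → Tendsto (fun n => π (F n t)) atTop (𝓝 y) := by
    intro t
    by_cases ht : t ∈ Icc α β
    · obtain ⟨y, hy⟩ := cauchySeq_tendsto_of_complete (hcauchy.cauchySeq ht)
      exact ⟨y, fun _ => hy⟩
    · exact ⟨0, fun h => absurd h ht⟩
  choose W hW using hex
  have hunif : TendstoUniformlyOn (fun n t => π (F n t)) W atTop (Icc α β) :=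
    hcauchy.tendstoUniformlyOn_of_tendsto hW
  -- The energy does not see the damper components. This is essential, since those converge only in
  -- `L²` and have no pointwise limit to put in place of `0`.
  have hlift : ∀ x : State V H,
      S.energyForm x x = S.energyForm ((π x).1, (π x).2, 0) ((π x).1, (π x).2, 0) := by
    intro x
    rw [energyForm_apply, energyForm_apply]
  refine ⟨W, hunif.continuousOn (Frequently.of_forall fun n => ?_), ?_, ?_, ?_⟩
  · have := (hF n).continuous
    exact Continuous.continuousOn (by fun_prop)
  -- Convergence in `L²` gives convergence almost everywhere along a subsequence, which identifies
  -- the uniform limit with `f`.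
  · have h1 : TendstoInMeasure volume F atTop f :=
      tendstoInMeasure_of_tendsto_eLpNorm (by norm_num) (fun n => (hFL n).1) hf.1 hlim
    obtain ⟨ns, hns, h2⟩ := h1.exists_seq_tendsto_ae
    filter_upwards [h2] with t h3 ht
    have hc : Continuous π := by fun_prop
    exact tendsto_nhds_unique ((hW t ht).comp hns.tendsto_atTop) ((hc.tendsto (f t)).comp h3)
  · intro s hs t ht
    have hc : ∀ t ∈ Icc α β, Tendsto (fun n => S.energyForm (F n t) (F n t)) atTop
        (𝓝 (S.energyForm ((W t).1, (W t).2, 0) ((W t).1, (W t).2, 0))) := by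
      intro t ht
      have : Continuous fun y : V × H => S.energyForm (y.1, y.2, 0) (y.1, y.2, 0) := by fun_prop
      exact ((this.tendsto (W t)).comp (hW t ht)).congr fun n => (hlift (F n t)).symm
    refine tendsto_nhds_unique ((hc t ht).sub (hc s hs)) ?_
    simp only [fun n => (hF n).energy_sub hS hs ht]
    exact (tendsto_setIntegral_bilin S.dissipation hFL hf hFL hf hlim hlim s t).neg
  · intro s hs t ht
    have hc : ∀ t ∈ Icc α β, Tendsto (fun n => S.i (F n t).1) atTop (𝓝 (S.i (W t).1)) := by
      intro t ht
      have : Continuous fun y : V × H => S.i y.1 := by fun_prop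
      exact (this.tendsto (W t)).comp (hW t ht)
    refine tendsto_nhds_unique ((hc t ht).sub (hc s hs)) ?_
    simp only [fun n => (hF n).position_sub hs ht]
    -- The integral of the velocity is written as a pairing with an indicator function, so that the
    -- bilinear limit lemma applies to a linear expression.
    set B : ℝ →L[ℝ] State V H →L[ℝ] H :=
      (ContinuousLinearMap.lsmul ℝ ℝ).bilinearComp (ContinuousLinearMap.id ℝ ℝ) velocity with hB
    set one : ℝ → ℝ := (uIcc s t).indicator fun _ => 1 with hone
    have h1 : MemLp one 2 volume := memLp_indicator_const 2 measurableSet_uIcc 1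
      (Or.inr (by simp [uIcc]))
    have h0 : Tendsto (fun _ : ℕ => eLpNorm (fun x => one x - one x) 2 volume) atTop (𝓝 0) := by
      simp
    have h2 := tendsto_setIntegral_bilin B (fun _ => h1) h1 hFL hf h0 hlim s t
    have h3 : ∀ g : ℝ → State V H, ∫ τ in s..t, B (one τ) (g τ) = ∫ τ in s..t, (g τ).2.1 := by
      intro g
      refine intervalIntegral.integral_congr fun τ hτ => ?_
      simp [hB, hone, indicator_of_mem hτ, velocity]
    simpa only [h3] using h2

end DampedWave

/-! ### One-sided mollifiers, and convolutions as pairings with test functions -/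

section Kernel

open scoped Convolution

/-- One-sided smooth kernels: their supports lie strictly between `0` and `d` and shrink to `0`. -/
lemma exists_oneSided_kernels {d : ℝ} (hd : d ≠ 0) :
    ∃ κ : ℕ → ℝ → ℝ, (∀ n, ContDiff ℝ ∞ (κ n)) ∧ (∀ n, HasCompactSupport (κ n)) ∧
      (∀ n x, 0 ≤ κ n x) ∧ (∀ n, ∫ x, κ n x = 1) ∧
      Tendsto (fun n => Function.support (κ n)) atTop (𝓝 0).smallSets ∧
      ∀ n, ∀ σ ∈ tsupport (κ n), ∃ ρ ∈ Ioo (0 : ℝ) 1, σ = ρ * d := by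
  have hd' : 0 < |d| := abs_pos.2 hd
  -- The outer radius is half the distance of the centre from `0`, so `σ / d` lies between `1/2` and
  -- `3/2` times `1 / (n + 2)`. The shift by `2` keeps it below `1` already for `n = 0`.
  set b : ∀ n : ℕ, ContDiffBump (d / (n + 2)) := fun n =>
    ⟨|d| / (4 * (n + 2)), |d| / (2 * (n + 2)), by positivity, by
      gcongr; norm_num⟩ with hb
  have hsupp : ∀ n : ℕ, ∀ σ ∈ tsupport ((b n).normed volume),
      ∃ ρ ∈ Ioo (0 : ℝ) 1, σ = ρ * d ∧ ρ ≤ 2 / (n + 2) := by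
    intro n σ hσ
    rw [ContDiffBump.tsupport_normed_eq, Metric.mem_closedBall, Real.dist_eq] at hσ
    change |σ - d / (n + 2)| ≤ |d| / (2 * (n + 2)) at hσ
    have h1 : |σ / d - 1 / (n + 2)| ≤ 1 / (2 * ((n : ℝ) + 2)) := by
      have h2 : σ / d - 1 / (n + 2) = (σ - d / (n + 2)) / d := by field_simp
      rw [h2, abs_div, div_le_iff₀ hd']
      refine hσ.trans (le_of_eq ?_)
      ring
    have h2 := abs_le.1 h1
    have hn : (0 : ℝ) < 1 / ((n : ℝ) + 2) := by positivity
    have hn' : 1 / ((n : ℝ) + 2) ≤ 1 / 2 := by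
      refine one_div_le_one_div_of_le (by norm_num) ?_
      have : (0 : ℝ) ≤ n := n.cast_nonneg
      linarith
    have h3 : 1 / (2 * ((n : ℝ) + 2)) = 1 / ((n : ℝ) + 2) / 2 := by
      rw [div_div, mul_comm]
    have h4 : 2 / ((n : ℝ) + 2) = 2 * (1 / ((n : ℝ) + 2)) := by ring
    rw [h3] at h2
    refine ⟨σ / d, ⟨by linarith, by linarith⟩, by field_simp, by rw [h4]; linarith⟩
  refine ⟨fun n => (b n).normed volume, fun n => (b n).contDiff_normed,
    fun n => (b n).hasCompactSupport_normed, fun n x => (b n).nonneg_normed x,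
    fun n => (b n).integral_normed, ?_, fun n σ hσ => ?_⟩
  · rw [tendsto_smallSets_iff]
    intro U hU
    obtain ⟨ε, hε, hεU⟩ := Metric.mem_nhds_iff.1 hU
    have h1 : Tendsto (fun n : ℕ => 2 / ((n : ℝ) + 2) * |d|) atTop (𝓝 0) := by
      have h2 : Tendsto (fun n : ℕ => (n : ℝ) + 2) atTop atTop :=
        tendsto_atTop_add_const_right _ _ tendsto_natCast_atTop_atTop
      simpa using (h2.const_div_atTop 2).mul_const |d|
    filter_upwards [h1.eventually_lt_const hε] with n hn σ hσ
    obtain ⟨ρ, hρ, rfl, hρ'⟩ := hsupp n σ (subset_tsupport _ hσ)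
    refine hεU ?_
    rw [Metric.mem_ball, dist_zero_right, norm_mul, Real.norm_eq_abs, Real.norm_eq_abs,
      abs_of_pos hρ.1]
    exact (mul_le_mul_of_nonneg_right hρ' hd'.le).trans_lt hn
  · obtain ⟨ρ, hρ, h, -⟩ := hsupp n σ hσ
    exact ⟨ρ, hρ, h⟩

/-- A convolution evaluated at `t` is a pairing with `s ↦ κ (t - s)`. This is an admissible test
function as soon as the kernel, placed at `t`, stays inside `U`. -/
lemma isTest_comp_sub_left {κ : ℝ → ℝ} (hκ : ContDiff ℝ ∞ κ) (hc : HasCompactSupport κ)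
    {U : Set ℝ} {t : ℝ} (h : ∀ σ ∈ tsupport κ, t - σ ∈ U) : IsTest U fun s => κ (t - s) where
  smooth := hκ.comp (contDiff_const.sub contDiff_id)
  compact := hc.comp_homeomorph (Homeomorph.subLeft t)
  supp := by
    intro s hs
    have h1 : t - s ∈ tsupport κ :=
      tsupport_comp_subset_preimage κ (by fun_prop : Continuous fun s => t - s) hs
    simpa using h _ h1

lemma IsTest.mono {U U' : Set ℝ} {φ : ℝ → ℝ} (h : IsTest U φ) (hU : U ⊆ U') : IsTest U' φ :=
  ⟨h.smooth, h.compact, h.supp.trans hU⟩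

lemma IsTest.continuous {U : Set ℝ} {φ : ℝ → ℝ} (h : IsTest U φ) : Continuous φ :=
  h.smooth.continuous

lemma IsTest.continuous_deriv {U : Set ℝ} {φ : ℝ → ℝ} (h : IsTest U φ) :
    Continuous (deriv φ) :=
  h.smooth.continuous_deriv (by simp)

lemma integrable_continuous_smul {E : Type*} [NormedAddCommGroup E] [NormedSpace ℝ E]
    {μ : Measure ℝ} {f : ℝ → E} (hf : Integrable f μ) {φ : ℝ → ℝ} (hφ : Continuous φ)
    (hc : HasCompactSupport φ) : Integrable (fun s => φ s • f s) μ := by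
  obtain ⟨C, hC⟩ := hc.exists_bound_of_continuous hφ
  exact hf.bdd_smul C hφ.aestronglyMeasurable (Eventually.of_forall hC)

lemma IsTest.integrable_smul {E : Type*} [NormedAddCommGroup E] [NormedSpace ℝ E] {U : Set ℝ}
    {φ : ℝ → ℝ} (h : IsTest U φ) {μ : Measure ℝ} {f : ℝ → E} (hf : Integrable f μ) :
    Integrable (fun s => φ s • f s) μ :=
  integrable_continuous_smul hf h.continuous h.compact

lemma IsTest.integrable_deriv_smul {E : Type*} [NormedAddCommGroup E] [NormedSpace ℝ E]
    {U : Set ℝ} {φ : ℝ → ℝ} (h : IsTest U φ) {μ : Measure ℝ} {f : ℝ → E} (hf : Integrable f μ) :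
    Integrable (fun s => deriv φ s • f s) μ :=
  integrable_continuous_smul hf h.continuous_deriv h.compact.deriv

/-- Continuous linear maps commute with the Bochner integral. Thus each scalar identity in the weak
formulation becomes an identity for the mollified state. -/
lemma clm_convolution_indicator {E G : Type*} [NormedAddCommGroup E] [NormedSpace ℝ E]
    [CompleteSpace E] [NormedAddCommGroup G] [NormedSpace ℝ G] [CompleteSpace G] (L : E →L[ℝ] G)
    {κ : ℝ → ℝ} (hκ : Continuous κ) (hc : HasCompactSupport κ) {A : Set ℝ} (hA : MeasurableSet A)
    {f : ℝ → E} (hf : Integrable f (volume.restrict A)) (t : ℝ) :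
    L ((κ ⋆[ContinuousLinearMap.lsmul ℝ ℝ, volume] A.indicator f) t)
      = ∫ s in A, κ (t - s) • L (f s) := by
  rw [convolution_lsmul_swap]
  have h1 : (fun s => κ (t - s) • A.indicator f s) = A.indicator fun s => κ (t - s) • f s := by
    ext1 s
    by_cases hs : s ∈ A <;> simp [hs]
  rw [h1, integral_indicator hA, ← L.integral_comp_comm]
  · simp
  · exact integrable_continuous_smul hf (by fun_prop : Continuous fun s => κ (t - s))
      (hc.comp_homeomorph (Homeomorph.subLeft t))

/-- The reflection in `s ↦ κ (t - s)` reverses the sign of the derivative, which matches the sign in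
the definition of a weak derivative. -/
lemma clm_convolution_deriv_indicator {E G : Type*} [NormedAddCommGroup E] [NormedSpace ℝ E]
    [CompleteSpace E] [NormedAddCommGroup G] [NormedSpace ℝ G] [CompleteSpace G] (L : E →L[ℝ] G)
    {κ : ℝ → ℝ} (hκ : Continuous (deriv κ)) (hc : HasCompactSupport κ) {A : Set ℝ}
    (hA : MeasurableSet A) {f : ℝ → E} (hf : Integrable f (volume.restrict A)) (t : ℝ) :
    L ((deriv κ ⋆[ContinuousLinearMap.lsmul ℝ ℝ, volume] A.indicator f) t)
      = -∫ s in A, deriv (fun s => κ (t - s)) s • L (f s) := by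
  have hd : ∀ s, deriv (fun s => κ (t - s)) s = -deriv κ (t - s) := fun s =>
    deriv_comp_const_sub _ _ _
  rw [clm_convolution_indicator L hκ hc.deriv hA hf t, ← integral_neg]
  simp only [hd, neg_smul, neg_neg]

end Kernel

/-! ### Weak solutions mollified in time -/

namespace DampedWave

open scoped Convolution

variable {V H : Type*} [NormedAddCommGroup V] [NormedSpace ℝ V]
  [NormedAddCommGroup H] [NormedSpace ℝ H] (S : DampedWave V H)

/-- Weak solutions of the damped wave equation on `(0, T)`; `θ j` is the derivative of the
functional `b j` along the solution if `k j ≠ 0`. -/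
structure WeakSolution (T : ℝ) (u : ℝ → V) (ut : ℝ → H) (θ : ℝ → Fin 2 → ℝ) : Prop where
  memLp_u : MemLp u 2 (volume.restrict (Ioo 0 T))
  memLp_ut : MemLp ut 2 (volume.restrict (Ioo 0 T))
  memLp_θ : MemLp θ 2 (volume.restrict (Ioo 0 T))
  velocity : ∀ φ : ℝ → ℝ, IsTest (Ioo 0 T) φ →
    ∫ t in Ioo 0 T, deriv φ t • S.i (u t) = -∫ t in Ioo 0 T, φ t • ut t
  damper : ∀ (j : Fin 2) (φ : ℝ → ℝ), IsTest (Ioo 0 T) φ →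
    S.k j * ∫ t in Ioo 0 T, deriv φ t * S.b j (u t) = -(S.k j * ∫ t in Ioo 0 T, φ t * θ t j)
  equation : ∀ (z : V) (φ : ℝ → ℝ), IsTest (Ioo 0 T) φ →
    -(∫ t in Ioo 0 T, deriv φ t * S.M (ut t) (S.i z))
      + (∫ t in Ioo 0 T, φ t * S.N (ut t) (S.i z)) + (∫ t in Ioo 0 T, φ t * S.a (u t) z)
      - ∑ j, S.k j * (∫ t in Ioo 0 T, deriv φ t * S.b j (u t)) * S.b j z = 0

variable {S} {T : ℝ} {u : ℝ → V} {ut : ℝ → H} {θ : ℝ → Fin 2 → ℝ}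

lemma WeakSolution.memLp_state (h : S.WeakSolution T u ut θ) :
    MemLp (fun t => ((u t, ut t, θ t) : State V H)) 2 (volume.restrict (Ioo 0 T)) :=
  MemLp.of_fst_snd ⟨h.memLp_u, MemLp.of_fst_snd ⟨h.memLp_ut, h.memLp_θ⟩⟩

/-- Mollifying a weak solution in time gives a smooth solution wherever the kernel does not reach
beyond the time interval. -/
lemma WeakSolution.smoothSolution [CompleteSpace V] [CompleteSpace H]
    (h : S.WeakSolution T u ut θ) {α β : ℝ} {κ : ℝ → ℝ} (hκ : ContDiff ℝ ∞ κ)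
    (hc : HasCompactSupport κ) (hsupp : ∀ t ∈ Icc α β, ∀ σ ∈ tsupport κ, t - σ ∈ Ioo 0 T) :
    S.SmoothSolution α β
      (κ ⋆[ContinuousLinearMap.lsmul ℝ ℝ, volume]
        (Ioo 0 T).indicator fun t => ((u t, ut t, θ t) : State V H))
      (deriv κ ⋆[ContinuousLinearMap.lsmul ℝ ℝ, volume]
        (Ioo 0 T).indicator fun t => ((u t, ut t, θ t) : State V H)) := by
  have hf := h.memLp_state
  have hfi := hf.integrable (by norm_num)
  have hloc : LocallyIntegrable ((Ioo 0 T).indicator fun t => ((u t, ut t, θ t) : State V H)) :=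
    ((memLp_indicator_iff_restrict measurableSet_Ioo).2 hf).locallyIntegrable (by norm_num)
  have hκ' : Continuous (deriv κ) := hκ.continuous_deriv (by simp)
  refine ⟨fun t => ?_, ?_, fun t ht => ?_⟩
  · exact hc.hasDerivAt_convolution_left _ (hκ.of_le (by simp)) hloc t
  · exact hc.deriv.continuous_convolution_left _ hκ' hloc
  have hφ : IsTest (Ioo 0 T) fun s => κ (t - s) := isTest_comp_sub_left hκ hc (hsupp t ht)
  set p : State V H →L[ℝ] V := ContinuousLinearMap.fst ℝ V (H × (Fin 2 → ℝ)) with hp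
  have d1 : ∀ j, S.b j ((deriv κ ⋆[ContinuousLinearMap.lsmul ℝ ℝ, volume]
        (Ioo 0 T).indicator fun t => ((u t, ut t, θ t) : State V H)) t).1
      = -∫ s in Ioo 0 T, deriv (fun s => κ (t - s)) s * S.b j (u s) := fun j =>
    clm_convolution_deriv_indicator ((S.b j).comp p) hκ' hc measurableSet_Ioo hfi t
  refine ⟨?_, fun j => ?_, fun z => ?_⟩
  · have h1 := clm_convolution_deriv_indicator (S.i.comp p) hκ' hc measurableSet_Ioo
      hfi t
    have h2 := clm_convolution_indicator (DampedWave.velocity : State V H →L[ℝ] H) hκ.continuous hc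
      measurableSet_Ioo hfi t
    have h3 := h.velocity _ hφ
    exact (h1.trans (neg_eq_iff_eq_neg.2 h3)).trans h2.symm
  · have h2 := clm_convolution_indicator (DampedWave.damper j : State V H →L[ℝ] ℝ) hκ.continuous hc
      measurableSet_Ioo hfi t
    have h3 := h.damper j _ hφ
    rw [d1, mul_neg, h3, neg_neg]
    exact congrArg _ h2.symm
  · have h1 := clm_convolution_deriv_indicator ((S.M.flip (S.i z)).comp DampedWave.velocity)
      hκ' hc measurableSet_Ioo
      hfi t
    have h2 := clm_convolution_indicator ((S.N.flip (S.i z)).comp DampedWave.velocity)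
      hκ.continuous hc
      measurableSet_Ioo hfi t
    have h3 := clm_convolution_indicator ((S.a.flip z).comp p) hκ.continuous hc
      measurableSet_Ioo hfi t
    have h4 := h.equation z _ hφ
    simp only [d1]
    refine Eq.trans ?_ h4
    have h1' : S.M ((deriv κ ⋆[ContinuousLinearMap.lsmul ℝ ℝ, volume]
        (Ioo 0 T).indicator fun t => ((u t, ut t, θ t) : State V H)) t).2.1 (S.i z)
        = -∫ s in Ioo 0 T, deriv (fun s => κ (t - s)) s * S.M (ut s) (S.i z) := h1
    have h2' : S.N ((κ ⋆[ContinuousLinearMap.lsmul ℝ ℝ, volume]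
        (Ioo 0 T).indicator fun t => ((u t, ut t, θ t) : State V H)) t).2.1 (S.i z)
        = ∫ s in Ioo 0 T, κ (t - s) * S.N (ut s) (S.i z) := h2
    have h3' : S.a ((κ ⋆[ContinuousLinearMap.lsmul ℝ ℝ, volume]
        (Ioo 0 T).indicator fun t => ((u t, ut t, θ t) : State V H)) t).1 z
        = ∫ s in Ioo 0 T, κ (t - s) * S.a (u s) z := h3
    rw [h1', h2', h3']
    simp only [Fin.sum_univ_two]
    ring

/-- The energy balance on an interval from which one can move a little in the direction `-d`
inside `(0, T)`. -/
lemma WeakSolution.exists_continuous_of_oneSided [CompleteSpace V] [CompleteSpace H]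
    (h : S.WeakSolution T u ut θ) {c : ℝ} (hS : S.Coercive c) {α β d : ℝ} (hαβ : α < β)
    (hd : d ≠ 0) (hI : ∀ t ∈ Icc α β, ∀ ρ ∈ Ioo (0 : ℝ) 1, t - ρ * d ∈ Ioo 0 T) :
    ∃ W : ℝ → V × H, ContinuousOn W (Icc α β) ∧
      (∀ᵐ t, t ∈ Icc α β ∩ Ioo 0 T → W t = (u t, ut t)) ∧
      (∀ s ∈ Icc α β, ∀ t ∈ Icc α β,
        S.energyForm ((W t).1, (W t).2, 0) ((W t).1, (W t).2, 0)
          - S.energyForm ((W s).1, (W s).2, 0) ((W s).1, (W s).2, 0)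
        = -∫ τ in s..t, (Ioo 0 T).indicator
            (fun τ => S.dissipation (u τ, ut τ, θ τ) (u τ, ut τ, θ τ)) τ) ∧
      (∀ s ∈ Icc α β, ∀ t ∈ Icc α β,
        S.i (W t).1 - S.i (W s).1 = ∫ τ in s..t, (Ioo 0 T).indicator ut τ) := by
  obtain ⟨κ, hκ, hc, hpos, h1, hsm, hsupp⟩ := exists_oneSided_kernels hd
  set f := (Ioo 0 T).indicator fun t => ((u t, ut t, θ t) : State V H) with hf
  have hfL : MemLp f 2 volume := (memLp_indicator_iff_restrict measurableSet_Ioo).2 h.memLp_state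
  have hlim := tendsto_eLpNorm_convolution_sub hfL (fun n => (hκ n).continuous) hc hpos h1 hsm
  -- Once the distance to `f` is finite, the mollification lies in `L²`. Dropping the first `n₀`
  -- kernels therefore provides this membership without a separate convolution inequality.
  obtain ⟨n₀, hn₀⟩ := eventually_atTop.1 (hlim.eventually_lt_const ENNReal.zero_lt_top)
  have hF := fun n => h.smoothSolution (α := α) (β := β) (hκ (n + n₀)) (hc (n + n₀))
    fun t ht σ hσ => by
    obtain ⟨ρ, hρ, rfl⟩ := hsupp _ σ hσ
    exact hI t ht ρ hρ
  rw [← hf] at hF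
  have hFL : ∀ n, MemLp (κ (n + n₀) ⋆[ContinuousLinearMap.lsmul ℝ ℝ, volume] f) 2 volume := by
    intro n
    have h2 : MemLp (fun t => (κ (n + n₀) ⋆[ContinuousLinearMap.lsmul ℝ ℝ, volume] f) t - f t) 2
        volume := ⟨(hF n).continuous.aestronglyMeasurable.sub hfL.1, hn₀ _ (by simp)⟩
    have h3 := h2.add hfL
    simpa [Pi.add_def] using h3
  obtain ⟨W, hW1, hW2, hW3, hW4⟩ := exists_continuous_limit hS hαβ hF hFL hfL
    ((tendsto_add_atTop_iff_nat n₀).2 hlim)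
  refine ⟨W, hW1, ?_, fun s hs t ht => ?_, fun s hs t ht => ?_⟩
  · filter_upwards [hW2] with t ht hmem
    rw [ht hmem.1, hf, indicator_of_mem hmem.2]
  · rw [hW3 s hs t ht]
    congr 2
    ext1 τ
    by_cases hτ : τ ∈ Ioo 0 T <;> simp [hf, hτ]
  · rw [hW4 s hs t ht]
    congr 1
    ext1 τ
    by_cases hτ : τ ∈ Ioo 0 T <;> simp [hf, hτ]

end DampedWave

/-! ### Gluing in time, differentiation up to the ends, initial values -/

lemma sub_eq_integral_of_overlap {E : Type*} [NormedAddCommGroup E] [NormedSpace ℝ E]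
    {Φ g : ℝ → E} {a b b' c : ℝ} (hb : b ≤ b') (hg : Integrable g)
    (h1 : ∀ s ∈ Icc a b', ∀ t ∈ Icc a b', Φ t - Φ s = ∫ τ in s..t, g τ)
    (h2 : ∀ s ∈ Icc b c, ∀ t ∈ Icc b c, Φ t - Φ s = ∫ τ in s..t, g τ)
    (ha : a ≤ b') (hbc : b' ≤ c) {t : ℝ} (ht : t ∈ Icc a c) :
    Φ t - Φ a = ∫ τ in a..t, g τ := by
  have hI : ∀ s t, IntervalIntegrable g volume s t := fun s t => hg.intervalIntegrable
  rcases le_total t b' with h | h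
  · exact h1 a ⟨le_rfl, ha⟩ t ⟨ht.1, h⟩
  · have e1 := h1 a ⟨le_rfl, ha⟩ b' ⟨ha, le_rfl⟩
    have e2 := h2 b' ⟨hb, hbc⟩ t ⟨hb.trans h, ht.2⟩
    rw [← intervalIntegral.integral_add_adjacent_intervals (hI a b') (hI b' t), ← e1, ← e2]
    abel

lemma hasDerivWithinAt_of_sub_eq_integral {E : Type*} [NormedAddCommGroup E] [NormedSpace ℝ E]
    [CompleteSpace E] {Φ g : ℝ → E} {T : ℝ} (hT : 0 ≤ T) (hg : ContinuousOn g (Icc 0 T))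
    (h : ∀ t ∈ Icc 0 T, Φ t - Φ 0 = ∫ τ in (0 : ℝ)..t, g τ) :
    ∀ t ∈ Icc 0 T, HasDerivWithinAt Φ (g t) (Icc 0 T) t := by
  intro t ht
  -- Extending `g` by its end values gives a function continuous on the whole line, so the
  -- fundamental theorem also applies at `0` and `T`.
  set G := IccExtend hT ((Icc 0 T).domRestrict g) with hG
  have hGc : Continuous G := (continuousOn_iff_continuous_domRestrict.1 hg).Icc_extend'
  have hGg : ∀ s ∈ Icc 0 T, G s = g s := fun s hs => by
    rw [hG, IccExtend_of_mem hT _ hs, domRestrict_apply]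
  have h1 : HasDerivAt (fun t => Φ 0 + ∫ τ in (0 : ℝ)..t, G τ) (G t) t :=
    (intervalIntegral.integral_hasDerivAt_right (hGc.intervalIntegrable _ _)
      (hGc.stronglyMeasurableAtFilter _ _) hGc.continuousAt).const_add _
  rw [← hGg t ht]
  have h2 : ∀ s ∈ Icc 0 T, Φ s = Φ 0 + ∫ τ in (0 : ℝ)..s, G τ := by
    intro s hs
    have h3 : ∫ τ in (0 : ℝ)..s, G τ = ∫ τ in (0 : ℝ)..s, g τ := by
      refine intervalIntegral.integral_congr fun τ hτ => hGg τ ?_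
      rw [uIcc_of_le hs.1] at hτ
      exact ⟨hτ.1, hτ.2.trans hs.2⟩
    rw [h3, ← h s hs]
    abel
  exact h1.hasDerivWithinAt.congr h2 (h2 t ht)

/-- The initial value carried by integration by parts against test functions on `(-∞, T)` is the
value at `0` of the continuous representative. -/
lemma eq_initial_value {E : Type*} [NormedAddCommGroup E] [NormedSpace ℝ E] [CompleteSpace E]
    {g q : ℝ → E} {T : ℝ} (hT : 0 < T) {c : E} (hg : ContinuousOn g (Icc 0 T))
    (hq : Integrable q (volume.restrict (Ioo 0 T)))
    (h : ∀ φ : ℝ → ℝ, IsTest (Iio T) φ →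
      ∫ t in Ioo 0 T, deriv φ t • g t = -(∫ t in Ioo 0 T, φ t • q t) - φ 0 • c) :
    g 0 = c := by
  -- The test functions are `t ↦ b (t / ε)`: they equal `1` at `0`, and their derivatives have
  -- integral `-1` over `(0, T)` and concentrate at `0` as `ε → 0`.
  set b : ContDiffBump (0 : ℝ) := ⟨1 / 2, 1, by norm_num, by norm_num⟩ with hb
  have hb0 : b 0 = 1 := b.one_of_mem_closedBall (by simp [hb])
  have hbts : tsupport b = Metric.closedBall 0 1 := b.tsupport_eq
  obtain ⟨C, hC⟩ := b.hasCompactSupport.deriv.exists_bound_of_continuous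
    ((b.contDiff (n := 1)).continuous_deriv le_rfl)
  have hC0 : 0 ≤ C := (norm_nonneg _).trans (hC 0)
  have hder : ∀ ε : ℝ, ∀ t, deriv (fun t => b (t / ε)) t = deriv b (t / ε) * ε⁻¹ := by
    intro ε t
    have h1 : DifferentiableAt ℝ b (t / ε) :=
      ((b.contDiff (n := 1)).differentiable (by simp)).differentiableAt
    have h2 := h1.hasDerivAt.comp t ((hasDerivAt_id t).div_const ε)
    simpa [Function.comp_def, one_div] using h2.deriv
  have htest : ∀ ε ∈ Ioo 0 T, IsTest (Iio T) fun t => b (t / ε) := by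
    intro ε hε
    refine ⟨b.contDiff.comp (contDiff_id.div_const ε), ?_, ?_⟩
    · exact b.hasCompactSupport.comp_homeomorph (Homeomorph.mulRight₀ ε⁻¹
        (inv_ne_zero hε.1.ne'))
    · intro t ht
      have h1 : t / ε ∈ tsupport b :=
        tsupport_comp_subset_preimage b (by fun_prop : Continuous fun t => t / ε) ht
      rw [hbts, Metric.mem_closedBall, dist_zero_right, Real.norm_eq_abs] at h1
      have h2 := (div_le_iff₀ hε.1).1 ((le_abs_self _).trans h1)
      exact lt_of_le_of_lt (by linarith) hε.2
  have hgi : Integrable g (volume.restrict (Ioo 0 T)) :=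
    (hg.integrableOn_Icc).mono_set Ioo_subset_Icc_self
  have hone : ∀ ε ∈ Ioo 0 T, ∫ t in Ioo 0 T, deriv (fun t => b (t / ε)) t = -1 := by
    intro ε hε
    rw [← integral_Ioc_eq_integral_Ioo, ← intervalIntegral.integral_of_le hT.le,
      intervalIntegral.integral_deriv_eq_sub
        (fun t _ => ((htest ε hε).smooth.differentiable (by simp)).differentiableAt)
        ((htest ε hε).continuous_deriv.intervalIntegrable _ _)]
    have h1 : b (T / ε) = 0 := b.zero_of_le_dist (by
      rw [dist_zero_right, Real.norm_eq_abs, abs_of_pos (div_pos hT hε.1)]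
      exact ((one_lt_div hε.1).2 hε.2).le)
    have h2 : b (0 / ε) = 1 := by rw [zero_div]; exact hb0
    rw [h1, h2, zero_sub]
  -- Both terms vanish in the limit. In the first, the derivative is at most `C / ε` on an interval
  -- of length `ε`, while `g t - g 0` is small there; the second is handled by dominated
  -- convergence.
  have hid : ∀ ε ∈ Ioo 0 T, g 0 - c = (∫ t in Ioo 0 T, deriv (fun t => b (t / ε)) t • (g t - g 0))
      + ∫ t in Ioo 0 T, b (t / ε) • q t := by
    intro ε hε
    have h1 := h _ (htest ε hε)
    have h2 : Integrable (fun t => deriv (fun t => b (t / ε)) t)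
        (volume.restrict (Ioo 0 T)) :=
      (htest ε hε).continuous_deriv.integrable_of_hasCompactSupport
        (htest ε hε).compact.deriv |>.mono_measure Measure.restrict_le_self
    simp only [smul_sub]
    rw [integral_sub ((htest ε hε).integrable_deriv_smul hgi) (h2.smul_const _),
      integral_smul_const, hone ε hε, h1, zero_div, hb0]
    simp only [neg_smul, one_smul]
    abel
  have hev : ∀ᶠ ε in 𝓝[>] (0 : ℝ), ε ∈ Ioo 0 T := Ioo_mem_nhdsGT hT
  have lim1 : Tendsto (fun ε => ∫ t in Ioo 0 T, deriv (fun t => b (t / ε)) t • (g t - g 0))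
      (𝓝[>] 0) (𝓝 0) := by
    rw [Metric.tendsto_nhds]
    intro δ hδ
    have h1 := Metric.continuousWithinAt_iff.1 (hg 0 ⟨le_rfl, hT.le⟩) (δ / (C + 1)) (by positivity)
    obtain ⟨ρ, hρ, h2⟩ := h1
    filter_upwards [hev, Ioo_mem_nhdsGT hρ] with ε hε hερ
    have h3 : ∫ t in Ioo 0 T, deriv (fun t => b (t / ε)) t • (g t - g 0)
        = ∫ t in Ioc 0 ε, deriv (fun t => b (t / ε)) t • (g t - g 0) := by
      refine setIntegral_eq_of_subset_of_forall_sdiff_eq_zero measurableSet_Ioo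
        (fun t ht => ⟨ht.1, ht.2.trans_lt hε.2⟩) fun t ht => ?_
      have h4 : ε < t := by
        by_contra h5
        exact ht.2 ⟨ht.1.1, not_lt.1 h5⟩
      have h5 : deriv b (t / ε) = 0 := by
        refine image_eq_zero_of_notMem_tsupport fun h6 => ?_
        have h7 := tsupport_deriv_subset (𝕜 := ℝ) (f := b) h6
        rw [hbts, Metric.mem_closedBall, dist_zero_right, Real.norm_eq_abs] at h7
        exact absurd ((le_abs_self _).trans h7) (not_le.2 ((one_lt_div hε.1).2 h4))
      rw [hder, h5, zero_mul, zero_smul]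
    rw [dist_zero_right, h3]
    have h4 : ∀ t ∈ Ioc 0 ε, ‖deriv (fun t => b (t / ε)) t • (g t - g 0)‖
        ≤ C * ε⁻¹ * (δ / (C + 1)) := by
      intro t ht
      rw [norm_smul, hder, norm_mul, norm_inv, Real.norm_eq_abs ε, abs_of_pos hε.1]
      have h5 : ‖g t - g 0‖ ≤ δ / (C + 1) := by
        rw [← dist_eq_norm]
        refine (h2 ⟨ht.1.le, ht.2.trans hε.2.le⟩ ?_).le
        rw [dist_zero_right, Real.norm_eq_abs, abs_of_pos ht.1]
        exact ht.2.trans_lt hερ.2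
      have := hε.1
      have := hC (t / ε)
      gcongr
    refine (norm_setIntegral_le_of_norm_le_const (by simp) h4).trans_lt ?_
    rw [Real.volume_real_Ioc_of_le hε.1.le, sub_zero]
    have h5 : C * ε⁻¹ * (δ / (C + 1)) * ε = C / (C + 1) * δ := by
      have := hε.1.ne'
      field_simp
    rw [h5]
    have h6 : C / (C + 1) < 1 := (div_lt_one (by positivity)).2 (by linarith)
    nlinarith
  have lim2 : Tendsto (fun ε => ∫ t in Ioo 0 T, b (t / ε) • q t) (𝓝[>] 0) (𝓝 0) := by
    have h1 : Tendsto (fun ε => ∫ t in Ioo 0 T, b (t / ε) • q t) (𝓝[>] 0)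
        (𝓝 (∫ t in Ioo 0 T, (0 : E))) := by
      refine tendsto_integral_filter_of_dominated_convergence (fun t => ‖q t‖) ?_ ?_ hq.norm ?_
      · filter_upwards [hev] with ε hε
        exact (htest ε hε).continuous.aestronglyMeasurable.smul hq.1
      · filter_upwards with ε
        filter_upwards with t
        rw [norm_smul, Real.norm_eq_abs, abs_of_nonneg b.nonneg]
        exact mul_le_of_le_one_left (norm_nonneg _) b.le_one
      · rw [ae_restrict_iff' measurableSet_Ioo]
        filter_upwards with t ht
        refine tendsto_const_nhds.congr' ?_
        filter_upwards [Ioo_mem_nhdsGT ht.1] with ε hε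
        have h2 : b (t / ε) = 0 := b.zero_of_le_dist (by
          rw [dist_zero_right, Real.norm_eq_abs, abs_of_pos (div_pos ht.1 hε.1)]
          exact ((one_lt_div hε.1).2 hε.2).le)
        rw [h2, zero_smul]
    simpa using h1
  have lim3 := lim1.add lim2
  rw [add_zero] at lim3
  have h1 : Tendsto (fun _ : ℝ => g 0 - c) (𝓝[>] 0) (𝓝 0) :=
    lim3.congr' (by filter_upwards [hev] with ε hε using (hid ε hε).symm)
  exact sub_eq_zero.1 (tendsto_nhds_unique tendsto_const_nhds h1)

/-! ### Continuity and energy identity for abstract weak solutions -/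

namespace DampedWave

variable {V H : Type*} [NormedAddCommGroup V] [NormedSpace ℝ V]
  [NormedAddCommGroup H] [NormedSpace ℝ H] {S : DampedWave V H}
  {T : ℝ} {u : ℝ → V} {ut : ℝ → H} {θ : ℝ → Fin 2 → ℝ}

/-- A weak solution is continuous in the energy space up to both ends of the time interval, and
satisfies the energy identity. -/
theorem WeakSolution.exists_continuous [CompleteSpace V] [CompleteSpace H]
    (h : S.WeakSolution T u ut θ) {c : ℝ} (hS : S.Coercive c) (hT : 0 < T) :
    ∃ (U : ℝ → V) (U' : ℝ → H),
      ContinuousOn U (Icc 0 T) ∧ ContinuousOn U' (Icc 0 T) ∧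
      (∀ᵐ t ∂(volume.restrict (Ioo 0 T)), U t = u t ∧ U' t = ut t) ∧
      (∀ t ∈ Icc 0 T, HasDerivWithinAt (fun s => S.i (U s)) (U' t) (Icc 0 T) t) ∧
      (∀ t ∈ Icc 0 T, S.energyForm (U t, U' t, 0) (U t, U' t, 0)
          + ∫ s in Ioo 0 t, S.dissipation (u s, ut s, θ s) (u s, ut s, θ s)
        = S.energyForm (U 0, U' 0, 0) (U 0, U' 0, 0)) := by
  -- With `d < 0` the kernel averages over later times, so `t = 0` is allowed; with `d > 0` below it
  -- averages over earlier times, so `t = T` is allowed. A reach of `T / 3` keeps both inside `(0,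
  -- T)`.
  obtain ⟨W₁, c₁, ae₁, en₁, i₁⟩ := h.exists_continuous_of_oneSided hS (α := 0) (β := 2 * T / 3)
    (d := -(T / 3)) (by linarith) (by linarith) fun t ht ρ hρ =>
      ⟨by nlinarith [ht.1, hρ.1], by nlinarith [ht.2, hρ.2]⟩
  obtain ⟨W₂, c₂, ae₂, en₂, i₂⟩ := h.exists_continuous_of_oneSided hS (α := T / 3) (β := T)
    (d := T / 3) (by linarith) (by linarith) fun t ht ρ hρ =>
      ⟨by nlinarith [ht.1, hρ.2], by nlinarith [ht.2, hρ.1]⟩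
  have h12 : EqOn W₁ W₂ (Icc (T / 3) (2 * T / 3)) := by
    refine Measure.eqOn_Icc_of_ae_eq volume (by linarith) ?_
      (c₁.mono (Icc_subset_Icc_left (by linarith))) (c₂.mono (Icc_subset_Icc_right (by linarith)))
    rw [Filter.EventuallyEq, ae_restrict_iff' measurableSet_Icc]
    filter_upwards [ae₁, ae₂] with t h1 h2 ht
    have ht' : t ∈ Ioo 0 T := ⟨by linarith [ht.1], by linarith [ht.2]⟩
    rw [h1 ⟨⟨ht'.1.le, ht.2⟩, ht'⟩, h2 ⟨⟨ht.1, ht'.2.le⟩, ht'⟩]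
  set W : ℝ → V × H := fun t => if t ≤ 2 * T / 3 then W₁ t else W₂ t with hW
  have hW1 : EqOn W W₁ (Icc 0 (2 * T / 3)) := fun t ht => if_pos ht.2
  have hW2 : EqOn W W₂ (Icc (T / 3) T) := by
    intro t ht
    by_cases h3 : t ≤ 2 * T / 3
    · rw [hW]
      simp only [if_pos h3]
      exact h12 ⟨ht.1, h3⟩
    · exact if_neg h3
  have hunion : Icc 0 (2 * T / 3) ∪ Icc (T / 3) T = Icc 0 T :=
    Icc_union_Icc' (by linarith) (by linarith) |>.trans (by
      rw [min_eq_left (by linarith), max_eq_right (by linarith)])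
  have hWc : ContinuousOn W (Icc 0 T) := by
    rw [← hunion]
    exact (c₁.congr hW1).union_of_isClosed (c₂.congr hW2) isClosed_Icc isClosed_Icc
  have hWae : ∀ᵐ t, t ∈ Ioo 0 T → W t = (u t, ut t) := by
    filter_upwards [ae₁, ae₂] with t h1 h2 ht
    by_cases h3 : t ≤ 2 * T / 3
    · rw [hW1 ⟨ht.1.le, h3⟩, h1 ⟨⟨ht.1.le, h3⟩, ht⟩]
    · have h4 : t ∈ Icc (T / 3) T := ⟨by linarith, ht.2.le⟩
      rw [hW2 h4, h2 ⟨h4, ht⟩]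
  have hut : Integrable ((Ioo 0 T).indicator ut) :=
    (integrable_indicator_iff measurableSet_Ioo).2 (h.memLp_ut.integrable (by norm_num))
  have hdiss : Integrable ((Ioo 0 T).indicator
      fun τ => S.dissipation (u τ, ut τ, θ τ) (u τ, ut τ, θ τ)) :=
    (integrable_indicator_iff measurableSet_Ioo).2
      (MemLp.integrable_bilin S.dissipation h.memLp_state h.memLp_state)
  have hi : ∀ t ∈ Icc 0 T, S.i (W t).1 - S.i (W 0).1 = ∫ τ in (0 : ℝ)..t, (W τ).2 := by
    intro t ht
    rw [sub_eq_integral_of_overlap (Φ := fun t => S.i (W t).1) (a := 0) (b := T / 3)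
      (b' := 2 * T / 3) (c := T) (by linarith) hut
      (fun s hs t ht => by simpa only [hW1 hs, hW1 ht] using i₁ s hs t ht)
      (fun s hs t ht => by simpa only [hW2 hs, hW2 ht] using i₂ s hs t ht)
      (by linarith) (by linarith) ht]
    refine intervalIntegral.integral_congr_ae ?_
    -- The interval integral runs over a half-open interval that may contain `T`, whereas `W` is
    -- identified only inside `(0, T)`.
    have hTn : ∀ᵐ τ : ℝ, τ ≠ T := by simp [ae_iff]
    filter_upwards [hWae, hTn] with τ h1 h2 hτ
    rw [uIoc_of_le ht.1] at hτ
    have hτ' : τ ∈ Ioo 0 T := ⟨hτ.1, lt_of_le_of_ne (hτ.2.trans ht.2) h2⟩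
    rw [indicator_of_mem hτ', h1 hτ']
  refine ⟨fun t => (W t).1, fun t => (W t).2, continuous_fst.comp_continuousOn hWc,
    continuous_snd.comp_continuousOn hWc, ?_, ?_, ?_⟩
  · rw [ae_restrict_iff' measurableSet_Ioo]
    filter_upwards [hWae] with t h1 ht
    rw [h1 ht]
    exact ⟨rfl, rfl⟩
  · exact hasDerivWithinAt_of_sub_eq_integral hT.le (continuous_snd.comp_continuousOn hWc) hi
  · intro t ht
    have h1 := sub_eq_integral_of_overlap
      (Φ := fun t => -S.energyForm ((W t).1, (W t).2, 0) ((W t).1, (W t).2, 0)) (a := 0)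
      (b := T / 3) (b' := 2 * T / 3) (c := T) (by linarith) hdiss
      (fun s hs t ht => by
        simp only [hW1 hs, hW1 ht]; linarith [en₁ s hs t ht])
      (fun s hs t ht => by
        simp only [hW2 hs, hW2 ht]; linarith [en₂ s hs t ht])
      (by linarith) (by linarith) ht
    have h2 : ∫ τ in (0 : ℝ)..t, (Ioo 0 T).indicator
          (fun τ => S.dissipation (u τ, ut τ, θ τ) (u τ, ut τ, θ τ)) τ
        = ∫ s in Ioo 0 t, S.dissipation (u s, ut s, θ s) (u s, ut s, θ s) := by
      rw [intervalIntegral.integral_of_le ht.1, integral_Ioc_eq_integral_Ioo]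
      refine setIntegral_congr_fun measurableSet_Ioo fun τ hτ => ?_
      exact indicator_of_mem (show τ ∈ Ioo 0 T from ⟨hτ.1, hτ.2.trans_le ht.2⟩) _
    rw [h2] at h1
    linarith

end DampedWave

/-! ### Sobolev functions of one variable: traces, completeness and Poincaré inequality for `𝒱²` -/

section Sobolev

variable {ℓ : ℝ}

/-- A test function with integral zero is the derivative of a test function. -/
lemma IsTest.exists_deriv_eq {a b : ℝ} {k : ℝ → ℝ} (hk : IsTest (Ioo a b) k)
    (h0 : ∫ x, k x = 0) : ∃ φ, IsTest (Ioo a b) φ ∧ deriv φ = k := by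
  rcases (tsupport k).eq_empty_or_nonempty with he | hne
  · refine ⟨k, hk, ?_⟩
    rw [tsupport_eq_empty_iff] at he
    rw [he]
    exact deriv_zero
  have hK : IsCompact (tsupport k) := hk.compact
  set p := sInf (tsupport k) with hp
  set q := sSup (tsupport k) with hq
  have hpm := hk.supp (hK.sInf_mem hne)
  have hqm := hk.supp (hK.sSup_mem hne)
  have hpq : tsupport k ⊆ Icc p q := fun x hx =>
    ⟨csInf_le hK.bddBelow hx, le_csSup hK.bddAbove hx⟩
  have hz : ∀ x, x ∉ Icc p q → k x = 0 := fun x hx =>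
    image_eq_zero_of_notMem_tsupport fun h => hx (hpq h)
  have hcont := hk.continuous
  have hki : Integrable k := hcont.integrable_of_hasCompactSupport hk.compact
  set φ : ℝ → ℝ := fun x => ∫ t in Iic x, k t with hφ
  have hφ' : ∀ x, φ x = φ 0 + ∫ t in (0 : ℝ)..x, k t := fun x => by
    rw [hφ, ← intervalIntegral.integral_Iic_sub_Iic hki.integrableOn hki.integrableOn]
    ring
  have hder : ∀ x, HasDerivAt φ (k x) x := by
    intro x
    have h1 : HasDerivAt (fun x => φ 0 + ∫ t in (0 : ℝ)..x, k t) (k x) x :=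
      (intervalIntegral.integral_hasDerivAt_right (hcont.intervalIntegrable _ _)
        (hcont.stronglyMeasurableAtFilter _ _) hcont.continuousAt).const_add _
    exact h1.congr_of_eventuallyEq (Eventually.of_forall hφ')
  have hd : deriv φ = k := funext fun x => (hder x).deriv
  -- The primitive vanishes to the left of `p` because `k` does, and to the right of `q` because the
  -- total integral of `k` is zero.
  have hsupp : Function.support φ ⊆ Icc p q := by
    intro x hx
    by_contra hxn
    refine hx ?_
    rw [mem_Icc, not_and_or, not_le, not_le] at hxn
    rcases hxn with h | h
    · exact setIntegral_eq_zero_of_forall_eq_zero fun t ht => hz t fun h' =>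
        absurd (h'.1.trans ht) (not_le.2 h)
    · rw [← h0]
      exact setIntegral_eq_integral_of_forall_compl_eq_zero fun t ht => hz t fun h' =>
        ht (h'.2.trans h.le)
  have hts : tsupport φ ⊆ Icc p q := closure_minimal hsupp isClosed_Icc
  refine ⟨φ, ⟨?_, HasCompactSupport.intro (isCompact_Icc (a := p) (b := q)) fun x hx => ?_, ?_⟩, hd⟩
  · rw [contDiff_infty_iff_deriv, hd]
    exact ⟨fun x => (hder x).differentiableAt, hk.smooth⟩
  · by_contra h
    exact hx (hsupp h)
  · exact hts.trans fun x hx => ⟨hpm.1.trans_le hx.1, hx.2.trans_lt hqm.2⟩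

lemma exists_isTest_integral_eq_one {a b : ℝ} (hab : a < b) :
    ∃ ρ, IsTest (Ioo a b) ρ ∧ ∫ x, ρ x = 1 := by
  set f : ContDiffBump ((a + b) / 2) := ⟨(b - a) / 8, (b - a) / 4, by linarith, by linarith⟩ with hf
  refine ⟨f.normed volume, ⟨f.contDiff_normed, f.hasCompactSupport_normed, ?_⟩, f.integral_normed⟩
  rw [f.tsupport_normed_eq, Real.closedBall_eq_Icc]
  intro x hx
  simp only [hf, mem_Icc] at hx
  exact ⟨by linarith [hx.1], by linarith [hx.2]⟩

lemma setIntegral_eq_integral_of_isTest {a b : ℝ} {φ : ℝ → ℝ} (h : IsTest (Ioo a b) φ) :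
    ∫ x in Ioo a b, φ x = ∫ x, φ x :=
  setIntegral_eq_integral_of_forall_compl_eq_zero fun _ hx =>
    image_eq_zero_of_notMem_tsupport fun h' => hx (h.supp h')

/-- The lemma of du Bois-Reymond. -/
lemma ae_eq_const_of_integral_deriv_mul_eq_zero {a b : ℝ} (hab : a < b) {f : ℝ → ℝ}
    (hf : Integrable f (volume.restrict (Ioo a b)))
    (h : ∀ φ, IsTest (Ioo a b) φ → ∫ x in Ioo a b, deriv φ x * f x = 0) :
    ∃ c, f =ᵐ[volume.restrict (Ioo a b)] fun _ => c := by
  obtain ⟨ρ, hρ, hρ1⟩ := exists_isTest_integral_eq_one hab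
  set c := ∫ x in Ioo a b, ρ x * f x with hc
  refine ⟨c, ?_⟩
  have hci : Integrable (fun _ : ℝ => c) (volume.restrict (Ioo a b)) := integrable_const c
  have key : ∀ᵐ x, x ∈ Ioo a b → f x - c = 0 := by
    refine isOpen_Ioo.ae_eq_zero_of_integral_contDiff_smul_eq_zero
      (IntegrableOn.locallyIntegrableOn (hf.sub hci)) fun g hg hgc hgs => ?_
    have hgt : IsTest (Ioo a b) g := ⟨hg, hgc, hgs⟩
    have e : ∫ x, g x • (f x - c) = ∫ x in Ioo a b, g x * (f x - c) := by
      symm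
      refine setIntegral_eq_integral_of_forall_compl_eq_zero fun x hx => ?_
      rw [image_eq_zero_of_notMem_tsupport fun h' => hx (hgs h'), zero_mul]
    rw [e]
    set I := ∫ x, g x with hI
    -- Subtracting `I * ρ` makes the integral zero, so this function is the derivative of a test
    -- function and the hypothesis applies to it.
    have hk : IsTest (Ioo a b) fun x => g x - I * ρ x := by
      refine ⟨hg.sub (contDiff_const.mul hρ.smooth), hgc.sub hρ.compact.mul_left, ?_⟩
      refine closure_minimal ?_ (isClosed_tsupport g |>.union (isClosed_tsupport ρ)) |>.trans
        (union_subset hgs hρ.supp)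
      intro x hx
      by_contra h'
      rw [mem_union, not_or] at h'
      refine hx ?_
      simp [image_eq_zero_of_notMem_tsupport h'.1, image_eq_zero_of_notMem_tsupport h'.2]
    have hgi : Integrable g := hg.continuous.integrable_of_hasCompactSupport hgc
    have hρi : Integrable ρ := hρ.continuous.integrable_of_hasCompactSupport hρ.compact
    obtain ⟨φ, hφ, hφd⟩ := hk.exists_deriv_eq (by
      rw [integral_sub hgi (hρi.const_mul _), integral_const_mul, hρ1, mul_one, sub_self])
    have h1 := h φ hφ
    rw [hφd] at h1
    have i1 : Integrable (fun x => g x * f x) (volume.restrict (Ioo a b)) :=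
      hgt.integrable_smul hf
    have i2 : Integrable (fun x => ρ x * f x) (volume.restrict (Ioo a b)) :=
      hρ.integrable_smul hf
    have h2 : ∫ x in Ioo a b, (g x - I * ρ x) * f x = (∫ x in Ioo a b, g x * f x) - I * c := by
      rw [hc, ← integral_const_mul, ← integral_sub i1 (i2.const_mul _)]
      congr 1; ext x; ring
    have h3 : ∫ x in Ioo a b, g x * (f x - c) = (∫ x in Ioo a b, g x * f x) - I * c := by
      simp only [mul_sub]
      rw [integral_sub i1 (hgi.restrict.mul_const _), integral_mul_const,
        setIntegral_eq_integral_of_isTest hgt]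
    rw [h3, ← h2, h1]
  rw [Filter.EventuallyEq, ae_restrict_iff' measurableSet_Ioo]
  filter_upwards [key] with x hx hm
  exact sub_eq_zero.1 (hx hm)

lemma L2.integrable (f : L2 ℓ) : Integrable (f : ℝ → ℝ) (volume.restrict (Ioo (0 : ℝ) ℓ)) :=
  (Lp.memLp f).integrable (by norm_num)

lemma L2.intervalIntegrable (hℓ : 0 < ℓ) (f : L2 ℓ) : IntervalIntegrable f volume 0 ℓ := by
  rw [intervalIntegrable_iff_integrableOn_Ioo_of_le hℓ.le]
  exact L2.integrable f

lemma setIntegral_Ioo_eq_intervalIntegral (hℓ : 0 < ℓ) (f : ℝ → ℝ) :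
    ∫ x in Ioo 0 ℓ, f x = ∫ x in (0 : ℝ)..ℓ, f x := by
  rw [intervalIntegral.integral_of_le hℓ.le, integral_Ioc_eq_integral_Ioo]

/-- Integration by parts of a primitive against a `C¹` function. -/
lemma integral_mul_eq_sub_of_primitive (hℓ : 0 < ℓ) (g : L2 ℓ) (c : ℝ) {ψ : ℝ → ℝ}
    (hψ : ContDiff ℝ 1 ψ) :
    ∫ x in Ioo 0 ℓ, ψ x * g x = ψ ℓ * (c + ∫ t in (0 : ℝ)..ℓ, g t) - ψ 0 * c
      - ∫ x in Ioo 0 ℓ, deriv ψ x * (c + ∫ t in (0 : ℝ)..x, g t) := by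
  have hg := L2.intervalIntegrable hℓ g
  set P : ℝ → ℝ := fun x => ∫ t in (0 : ℝ)..x, g t with hP
  -- `P` has derivative `g` only almost everywhere; absolute continuity is what justifies the
  -- integration by parts.
  have hPac : AbsolutelyContinuousOnInterval P 0 ℓ :=
    hg.absolutelyContinuousOnInterval_intervalIntegral left_mem_uIcc
  have hψac : AbsolutelyContinuousOnInterval ψ 0 ℓ :=
    hψ.contDiffOn.absolutelyContinuousOnInterval
  have h1 := hψac.integral_mul_deriv_eq_deriv_mul hPac
  have h2 : ∫ x in (0 : ℝ)..ℓ, ψ x * deriv P x = ∫ x in (0 : ℝ)..ℓ, ψ x * g x := by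
    refine intervalIntegral.integral_congr_ae ?_
    filter_upwards [hg.ae_hasDerivAt_integral] with x hx hm
    rw [(hx (uIoc_subset_uIcc hm) 0 left_mem_uIcc).deriv]
  have hP0 : P 0 = 0 := by simp [hP]
  have h3 : ∫ x in (0 : ℝ)..ℓ, deriv ψ x * (c + P x)
      = c * (ψ ℓ - ψ 0) + ∫ x in (0 : ℝ)..ℓ, deriv ψ x * P x := by
    have hψ' := hψ.continuous_deriv le_rfl
    have hi : IntervalIntegrable (fun x => deriv ψ x * P x) volume 0 ℓ :=
      (hψ'.continuousOn.mul hPac.continuousOn).intervalIntegrable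
    rw [← intervalIntegral.integral_deriv_eq_sub
      (fun x _ => (hψ.differentiable (by simp)).differentiableAt) (hψ'.intervalIntegrable _ _),
      ← intervalIntegral.integral_const_mul, ← intervalIntegral.integral_add
      ((hψ'.intervalIntegrable _ _).const_mul _) hi]
    congr 1; ext x; ring
  rw [setIntegral_Ioo_eq_intervalIntegral hℓ, setIntegral_Ioo_eq_intervalIntegral hℓ, h3, ← h2, h1,
    hP0]
  ring

/-- A function in `L²` with a weak derivative in `L²` is a primitive of its derivative. -/
lemma HasWeakDeriv.exists_primitive (hℓ : 0 < ℓ) {f g : L2 ℓ} (h : HasWeakDeriv 0 ℓ f g) :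
    ∃ c, IsContRep f fun x => c + ∫ t in (0 : ℝ)..x, g t := by
  have hg := L2.intervalIntegrable hℓ g
  set P : ℝ → ℝ := fun x => ∫ t in (0 : ℝ)..x, g t with hP
  have hPc : ContinuousOn P (Icc 0 ℓ) := by
    have := (hg.absolutelyContinuousOnInterval_intervalIntegral left_mem_uIcc).continuousOn
    rwa [uIcc_of_le hℓ.le] at this
  have hPi : Integrable P (volume.restrict (Ioo 0 ℓ)) :=
    (hPc.integrableOn_Icc).mono_set Ioo_subset_Icc_self
  -- The difference `f - P` has zero weak derivative.
  obtain ⟨c, hc⟩ := ae_eq_const_of_integral_deriv_mul_eq_zero hℓ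
    ((L2.integrable f).sub hPi) fun φ hφ => by
      have h1 := h φ hφ
      have h2 := integral_mul_eq_sub_of_primitive hℓ g 0
        (hφ.smooth.of_le (by simp) : ContDiff ℝ 1 φ)
      have h3 : φ ℓ = 0 := image_eq_zero_of_notMem_tsupport fun h' => lt_irrefl _ (hφ.supp h').2
      simp only [zero_add, h3, zero_mul, mul_zero, sub_zero, zero_sub] at h2
      simp only [smul_eq_mul] at h1
      simp only [Pi.sub_apply, mul_sub]
      have i1 : Integrable (fun x => deriv φ x * f x) (volume.restrict (Ioo 0 ℓ)) :=
        hφ.integrable_deriv_smul (L2.integrable f)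
      have i2 : Integrable (fun x => deriv φ x * P x) (volume.restrict (Ioo 0 ℓ)) :=
        hφ.integrable_deriv_smul hPi
      rw [integral_sub i1 i2, h1, h2]
      simp [hP]
  refine ⟨c, continuousOn_const.add hPc, ?_⟩
  filter_upwards [hc] with x hx
  rw [← hx]
  simp [hP]

lemma IsContRep.eqOn (hℓ : 0 < ℓ) {f : L2 ℓ} {F G : ℝ → ℝ} (hF : IsContRep f F)
    (hG : IsContRep f G) : EqOn F G (Icc 0 ℓ) := by
  refine Measure.eqOn_Icc_of_ae_eq volume hℓ.ne ?_ hF.1 hG.1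
  rw [← restrict_Ioo_eq_restrict_Icc]
  exact hF.2.symm.trans hG.2

lemma IsContRep.value_eq (hℓ : 0 < ℓ) {f : L2 ℓ} {F : ℝ → ℝ} (hF : IsContRep f F) {a : ℝ}
    (ha : a ∈ Icc 0 ℓ) : value f a = F a := by
  have h : ∃ F, IsContRep f F := ⟨F, hF⟩
  rw [value, dif_pos h]
  exact h.choose_spec.eqOn hℓ hF ha

lemma HasWeakDeriv.isContRep_value (hℓ : 0 < ℓ) {f g : L2 ℓ} (h : HasWeakDeriv 0 ℓ f g) :
    IsContRep f (value f) := by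
  obtain ⟨c, hc⟩ := h.exists_primitive hℓ
  refine ⟨hc.1.congr fun x hx => hc.value_eq hℓ hx, ?_⟩
  have h1 := hc.2
  rw [Filter.EventuallyEq, ae_restrict_iff' measurableSet_Ioo] at h1 ⊢
  filter_upwards [h1] with x hx hm
  rw [hx hm, hc.value_eq hℓ (Ioo_subset_Icc_self hm)]

lemma HasWeakDeriv.value_sub (hℓ : 0 < ℓ) {f g : L2 ℓ} (h : HasWeakDeriv 0 ℓ f g) {x y : ℝ}
    (hx : x ∈ Icc 0 ℓ) (hy : y ∈ Icc 0 ℓ) : value f y - value f x = ∫ t in x..y, g t := by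
  obtain ⟨c, hc⟩ := h.exists_primitive hℓ
  have hg := L2.intervalIntegrable hℓ g
  have hI : ∀ z ∈ Icc 0 ℓ, IntervalIntegrable g volume 0 z := fun z hz =>
    hg.mono_set (by rw [uIcc_of_le hz.1, uIcc_of_le hℓ.le]; exact Icc_subset_Icc_right hz.2)
  rw [hc.value_eq hℓ hx, hc.value_eq hℓ hy,
    ← intervalIntegral.integral_interval_sub_left (hI y hy) (hI x hx)]
  ring

/-- Integration by parts with boundary terms. -/
lemma HasWeakDeriv.integral_mul_eq (hℓ : 0 < ℓ) {f g : L2 ℓ} (h : HasWeakDeriv 0 ℓ f g)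
    {ψ : ℝ → ℝ} (hψ : ContDiff ℝ 1 ψ) :
    ∫ x in Ioo 0 ℓ, ψ x * g x = ψ ℓ * value f ℓ - ψ 0 * value f 0
      - ∫ x in Ioo 0 ℓ, deriv ψ x * f x := by
  obtain ⟨c, hc⟩ := h.exists_primitive hℓ
  rw [integral_mul_eq_sub_of_primitive hℓ g c hψ, hc.value_eq hℓ (right_mem_Icc.2 hℓ.le),
    hc.value_eq hℓ (left_mem_Icc.2 hℓ.le), intervalIntegral.integral_same, add_zero]
  congr 1
  refine integral_congr_ae ?_
  filter_upwards [hc.2] with x hx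
  rw [hx]

lemma Continuous.memLp_restrict_Ioo {ψ : ℝ → ℝ} (hψ : Continuous ψ) (a b : ℝ) :
    MemLp ψ 2 (volume.restrict (Ioo a b)) := by
  obtain ⟨C, hC⟩ := isCompact_Icc.exists_bound_of_continuousOn (hψ.continuousOn (s := Icc a b))
  refine MemLp.of_bound hψ.aestronglyMeasurable C ?_
  rw [ae_restrict_iff' measurableSet_Ioo]
  exact Eventually.of_forall fun x hx => hC x (Ioo_subset_Icc_self hx)

/-- The functional `f ↦ ∫ ψ f` on `L²(0, ℓ)`. -/
def L2.pairing (ℓ : ℝ) (ψ : ℝ → ℝ) (hψ : Continuous ψ) : L2 ℓ →L[ℝ] ℝ :=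
  innerSL ℝ ((Continuous.memLp_restrict_Ioo hψ 0 ℓ).toLp ψ)

lemma L2.pairing_apply {ψ : ℝ → ℝ} (hψ : Continuous ψ) (f : L2 ℓ) :
    L2.pairing ℓ ψ hψ f = ∫ x in Ioo 0 ℓ, ψ x * f x := by
  rw [L2.pairing, innerSL_apply_apply, L2.inner_def]
  refine integral_congr_ae ?_
  filter_upwards [(Continuous.memLp_restrict_Ioo hψ 0 ℓ).coeFn_toLp] with x hx
  rw [hx]
  simp [mul_comm]

/-- The value at `ℓ` (for `a = 0`) or at `0` (for `a = 1`) of a function `f` with weak derivative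
`g`, as a functional of `(f, g)`. -/
def endFunctional (ℓ a : ℝ) : L2 ℓ × L2 ℓ →L[ℝ] ℝ :=
  ((L2.pairing ℓ (fun _ => 1 / ℓ) continuous_const).comp (ContinuousLinearMap.fst ℝ _ _))
    + (L2.pairing ℓ (fun x => x / ℓ - a) (by fun_prop)).comp (ContinuousLinearMap.snd ℝ _ _)

/-- Integration by parts against the affine function `x / ℓ - a`, which vanishes at one end when `a`
is `0` or `1`. It exhibits the trace as a bounded functional of `(f, g)`, and this gives both the
closedness of `𝒱²` and the continuity of the end slopes. -/
lemma HasWeakDeriv.endFunctional_eq (hℓ : 0 < ℓ) {f g : L2 ℓ} (h : HasWeakDeriv 0 ℓ f g) (a : ℝ) :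
    endFunctional ℓ a (f, g) = (1 - a) * value f ℓ + a * value f 0 := by
  have h1 := h.integral_mul_eq hℓ (ψ := fun x => x / ℓ - a) (by fun_prop)
  have h2 : ∀ x, deriv (fun x => x / ℓ - a) x = 1 / ℓ := fun x =>
    (((hasDerivAt_id x).div_const ℓ).sub_const a).deriv
  simp only [h2, div_self hℓ.ne', zero_div] at h1
  simp only [endFunctional, add_apply, ContinuousLinearMap.comp_apply,
    ContinuousLinearMap.coe_fst', ContinuousLinearMap.coe_snd', L2.pairing_apply]
  rw [h1]
  ring

lemma hasWeakDeriv_iff_pairing {f g : L2 ℓ} : HasWeakDeriv 0 ℓ f g ↔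
    ∀ φ (h : IsTest (Ioo 0 ℓ) φ),
      L2.pairing ℓ (deriv φ) h.continuous_deriv f + L2.pairing ℓ φ h.continuous g = 0 := by
  refine forall₂_congr fun φ h => ?_
  rw [L2.pairing_apply, L2.pairing_apply, ← eq_neg_iff_add_eq_zero]
  rfl

/-- Each test function imposes one closed condition, the vanishing of a continuous functional of the
pair. -/
lemma isClosed_hasWeakDeriv {X : Type*} [TopologicalSpace X] {f g : X → L2 ℓ} (hf : Continuous f)
    (hg : Continuous g) : IsClosed {x | HasWeakDeriv 0 ℓ (f x) (g x)} := by
  simp only [hasWeakDeriv_iff_pairing, ofPred_forall]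
  exact isClosed_iInter fun φ => isClosed_iInter fun h =>
    isClosed_eq (by fun_prop) continuous_const

lemma mem_V2_iff (hℓ : 0 < ℓ) {v : Jet ℓ} : v ∈ V2 ℓ ↔
    HasWeakDeriv 0 ℓ (fn v) (d1 v) ∧ HasWeakDeriv 0 ℓ (d1 v) (d2 v) ∧
      value (fn v) 0 = 0 ∧ value (fn v) ℓ = 0 := by
  constructor
  · rintro ⟨⟨h1, h2⟩, F, hF, hF0, hFl⟩
    exact ⟨h1, h2, by rw [hF.value_eq hℓ (left_mem_Icc.2 hℓ.le), hF0],
      by rw [hF.value_eq hℓ (right_mem_Icc.2 hℓ.le), hFl]⟩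
  · rintro ⟨h1, h2, h3, h4⟩
    exact ⟨⟨h1, h2⟩, _, h1.isContRep_value hℓ, h3, h4⟩

lemma isClosed_V2 (hℓ : 0 < ℓ) : IsClosed (V2 ℓ : Set (Jet ℓ)) := by
  have h1 : IsClosed {v : Jet ℓ | HasWeakDeriv 0 ℓ (fn v) (d1 v)} :=
    isClosed_hasWeakDeriv continuous_fst (continuous_fst.comp continuous_snd)
  have h2 : IsClosed {v : Jet ℓ | HasWeakDeriv 0 ℓ (d1 v) (d2 v)} :=
    isClosed_hasWeakDeriv (continuous_fst.comp continuous_snd) (continuous_snd.comp continuous_snd)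
  have hc : Continuous fun v : Jet ℓ => (fn v, d1 v) :=
    continuous_fst.prodMk (continuous_fst.comp continuous_snd)
  have h3 : ∀ a, IsClosed {v : Jet ℓ | endFunctional ℓ a (fn v, d1 v) = 0} := fun a =>
    isClosed_eq ((endFunctional ℓ a).continuous.comp hc) continuous_const
  convert h1.inter (h2.inter ((h3 1).inter (h3 0))) using 1
  ext v
  rw [SetLike.mem_coe, mem_V2_iff hℓ]
  simp only [mem_inter_iff, mem_ofPred_eq]
  refine and_congr_right fun h => and_congr_right fun _ => ?_
  rw [h.endFunctional_eq hℓ, h.endFunctional_eq hℓ]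
  simp

lemma completeSpace_V2 (hℓ : 0 < ℓ) : CompleteSpace (V2 ℓ) :=
  (isClosed_V2 hℓ).completeSpace_coe

/-- The constant function `1` in `L²(0, ℓ)`. -/
def L2.one (ℓ : ℝ) : L2 ℓ :=
  (Continuous.memLp_restrict_Ioo (continuous_const (y := (1 : ℝ))) 0 ℓ).toLp _

lemma L2.coeFn_one : L2.one ℓ =ᵐ[volume.restrict (Ioo 0 ℓ)] fun _ => 1 := MemLp.coeFn_toLp _

/-- Cauchy–Schwarz against the constant function `1`. -/
lemma L2.integral_abs_le (g : L2 ℓ) : ∫ x in Ioo 0 ℓ, |g x| ≤ ‖L2.one ℓ‖ * ‖g‖ := by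
  have h1 : ∫ x in Ioo 0 ℓ, |g x| = inner ℝ (L2.one ℓ) |g| := by
    rw [L2.inner_def]
    refine integral_congr_ae ?_
    filter_upwards [L2.coeFn_one (ℓ := ℓ), Lp.coeFn_abs g] with x h1 h2
    rw [h1, h2]
    simp
  rw [h1]
  refine (real_inner_le_norm _ _).trans ?_
  rw [norm_abs_eq_norm]

/-- A function with a zero is controlled in `L²` by its weak derivative. -/
lemma HasWeakDeriv.norm_le (hℓ : 0 < ℓ) {f g : L2 ℓ} (h : HasWeakDeriv 0 ℓ f g) {x₀ : ℝ}
    (hx₀ : x₀ ∈ Icc 0 ℓ) (h0 : value f x₀ = 0) : ‖f‖ ≤ ‖L2.one ℓ‖ ^ 2 * ‖g‖ := by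
  have hpt : ∀ x ∈ Icc 0 ℓ, |value f x| ≤ ‖L2.one ℓ‖ * ‖g‖ := by
    intro x hx
    have h1 := h.value_sub hℓ hx₀ hx
    rw [h0, sub_zero] at h1
    rw [h1]
    refine (intervalIntegral.norm_integral_le_integral_norm_uIoc (f := g)).trans ?_
    refine le_trans ?_ (L2.integral_abs_le g)
    rw [← integral_Ioc_eq_integral_Ioo]
    refine setIntegral_mono_set ?_ (Eventually.of_forall fun x => abs_nonneg _) ?_
    · have := (L2.intervalIntegrable hℓ g).abs
      rwa [intervalIntegrable_iff_integrableOn_Ioc_of_le hℓ.le] at this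
    · refine Eventually.of_forall fun y hy => ?_
      exact ⟨(le_min hx₀.1 hx.1).trans_lt hy.1, hy.2.trans (max_le hx₀.2 hx.2)⟩
  have h1 : ‖f‖ ≤ ‖L2.one ℓ‖ * ‖g‖ * ‖L2.one ℓ‖ := by
    refine Lp.norm_le_mul_norm_of_ae_le_mul ?_
    have h2 := (h.isContRep_value hℓ).2
    have h3 : ∀ᵐ x ∂(volume.restrict (Ioo 0 ℓ)), x ∈ Ioo 0 ℓ := ae_restrict_mem measurableSet_Ioo
    filter_upwards [h2, h3, L2.coeFn_one (ℓ := ℓ)] with x h2 h3 h4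
    rw [h2, h4, norm_one, mul_one]
    exact hpt x (Ioo_subset_Icc_self h3)
  linarith

/-- Rolle's theorem for functions with a weak derivative in `H¹`. -/
lemma exists_value_deriv_eq_zero (hℓ : 0 < ℓ) {v : Jet ℓ} (hv : v ∈ V2 ℓ) :
    ∃ x ∈ Icc 0 ℓ, value (d1 v) x = 0 := by
  obtain ⟨h1, h2, h3, h4⟩ := (mem_V2_iff hℓ).1 hv
  have hG := h2.isContRep_value hℓ
  set G := value (d1 v) with hGdef
  have hGi : IntervalIntegrable G volume 0 ℓ := hG.1.intervalIntegrable_of_Icc hℓ.le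
  have hint : ∫ t in (0 : ℝ)..ℓ, G t = 0 := by
    have h5 := h1.value_sub hℓ (left_mem_Icc.2 hℓ.le) (right_mem_Icc.2 hℓ.le)
    rw [h3, h4, sub_zero] at h5
    refine Eq.trans ?_ h5.symm
    rw [← setIntegral_Ioo_eq_intervalIntegral hℓ, ← setIntegral_Ioo_eq_intervalIntegral hℓ]
    refine integral_congr_ae ?_
    filter_upwards [hG.2] with x hx using hx.symm
  have hcont : ContinuousOn (fun x => ∫ t in (0 : ℝ)..x, G t) (Icc 0 ℓ) := by
    have := (hGi.absolutelyContinuousOnInterval_intervalIntegral left_mem_uIcc).continuousOn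
    rwa [uIcc_of_le hℓ.le] at this
  -- Rolle is applied to the primitive of the continuous representative of `v'`. It vanishes at `ℓ`
  -- because `v` vanishes at both ends.
  obtain ⟨x, hx, hx0⟩ := exists_hasDerivAt_eq_zero (f := fun x => ∫ t in (0 : ℝ)..x, G t)
    (f' := G) hℓ hcont (by simp [hint]) fun x hx =>
      intervalIntegral.integral_hasDerivAt_right
        (hGi.mono_set (by
          rw [uIcc_of_le hx.1.le, uIcc_of_le hℓ.le]; exact Icc_subset_Icc_right hx.2.le))
        ((hG.1.mono Ioo_subset_Icc_self).stronglyMeasurableAtFilter isOpen_Ioo x hx)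
        (hG.1.continuousAt (Icc_mem_nhds hx.1 hx.2))
  exact ⟨x, Ioo_subset_Icc_self hx, hx0⟩

/-- On `𝒱²` the norm is controlled by the second derivative. -/
lemma exists_norm_le_d2 (hℓ : 0 < ℓ) : ∃ C, 0 < C ∧ ∀ v : V2 ℓ, ‖v‖ ≤ C * ‖d2 (v : Jet ℓ)‖ := by
  set K := ‖L2.one ℓ‖ ^ 2 with hK
  have hK0 : 0 ≤ K := by positivity
  -- The constant dominates `K * K`, `K` and `1`, the bounds for `v`, `v'` and `v''`.
  refine ⟨1 + K + K * K, by positivity, fun v => ?_⟩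
  obtain ⟨h1, h2, h3, h4⟩ := (mem_V2_iff hℓ).1 v.2
  obtain ⟨x, hx, hx0⟩ := exists_value_deriv_eq_zero hℓ v.2
  have e1 := h1.norm_le hℓ (left_mem_Icc.2 hℓ.le) h3
  have e2 := h2.norm_le hℓ hx hx0
  rw [← hK] at e1 e2
  have n2 := norm_nonneg (d2 (v : Jet ℓ))
  have n0 : 0 ≤ K * ‖d2 (v : Jet ℓ)‖ := by positivity
  have n1 : 0 ≤ K * (K * ‖d2 (v : Jet ℓ)‖) := by positivity
  have e3 : ‖fn (v : Jet ℓ)‖ ≤ K * (K * ‖d2 (v : Jet ℓ)‖) := e1.trans (by gcongr)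
  have e4 : ‖v‖ = max ‖fn (v : Jet ℓ)‖ (max ‖d1 (v : Jet ℓ)‖ ‖d2 (v : Jet ℓ)‖) := rfl
  rw [e4]
  refine max_le ?_ (max_le ?_ ?_) <;> nlinarith

/-- The slope at `0` (for `a = 1`) or at `ℓ` (for `a = 0`) on `𝒱²`. -/
def endSlope (ℓ a : ℝ) : V2 ℓ →L[ℝ] ℝ :=
  (endFunctional ℓ a).comp ((ContinuousLinearMap.snd ℝ (L2 ℓ) (L2 ℓ × L2 ℓ)).comp (V2 ℓ).subtypeL)

lemma endSlope_one (hℓ : 0 < ℓ) (v : V2 ℓ) : endSlope ℓ 1 v = value (d1 (v : Jet ℓ)) 0 := by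
  have h := ((mem_V2_iff hℓ).1 v.2).2.1.endFunctional_eq hℓ 1
  have e : endSlope ℓ 1 v = endFunctional ℓ 1 (d1 (v : Jet ℓ), d2 (v : Jet ℓ)) := rfl
  rw [e, h]
  ring

lemma endSlope_zero (hℓ : 0 < ℓ) (v : V2 ℓ) : endSlope ℓ 0 v = value (d1 (v : Jet ℓ)) ℓ := by
  have h := ((mem_V2_iff hℓ).1 v.2).2.1.endFunctional_eq hℓ 0
  have e : endSlope ℓ 0 v = endFunctional ℓ 0 (d1 (v : Jet ℓ), d2 (v : Jet ℓ)) := rfl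
  rw [e, h]
  ring

/-- The class in `L²(0, ℓ)` of a continuous function. -/
def L2.ofContinuous (ℓ : ℝ) (p : ℝ → ℝ) (hp : Continuous p) : L2 ℓ :=
  (Continuous.memLp_restrict_Ioo hp 0 ℓ).toLp p

lemma L2.isContRep_ofContinuous {p : ℝ → ℝ} (hp : Continuous p) :
    IsContRep (L2.ofContinuous ℓ p hp) p :=
  ⟨hp.continuousOn, MemLp.coeFn_toLp _⟩

lemma L2.hasWeakDeriv_ofContinuous (hℓ : 0 < ℓ) {p : ℝ → ℝ} (hp : ContDiff ℝ 1 p) :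
    HasWeakDeriv 0 ℓ (L2.ofContinuous ℓ p hp.continuous)
      (L2.ofContinuous ℓ (deriv p) (hp.continuous_deriv le_rfl)) := by
  intro φ hφ
  have h0 : φ 0 = 0 := image_eq_zero_of_notMem_tsupport fun h' => lt_irrefl _ (hφ.supp h').1
  have h1 : φ ℓ = 0 := image_eq_zero_of_notMem_tsupport fun h' => lt_irrefl _ (hφ.supp h').2
  have hφ1 : ContDiff ℝ 1 φ := hφ.smooth.of_le (by simp)
  have e1 : ∫ s in Ioo 0 ℓ, deriv φ s • L2.ofContinuous ℓ p hp.continuous s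
      = ∫ s in (0 : ℝ)..ℓ, deriv φ s * p s := by
    rw [← setIntegral_Ioo_eq_intervalIntegral hℓ]
    refine integral_congr_ae ?_
    filter_upwards [(L2.isContRep_ofContinuous (ℓ := ℓ) hp.continuous).2] with x hx
    rw [hx, smul_eq_mul]
  have e2 : ∫ s in Ioo 0 ℓ, φ s • L2.ofContinuous ℓ (deriv p) (hp.continuous_deriv le_rfl) s
      = ∫ s in (0 : ℝ)..ℓ, φ s * deriv p s := by
    rw [← setIntegral_Ioo_eq_intervalIntegral hℓ]
    refine integral_congr_ae ?_
    filter_upwards [(L2.isContRep_ofContinuous (ℓ := ℓ) (hp.continuous_deriv le_rfl)).2] with x hx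
    rw [hx, smul_eq_mul]
  rw [e1, e2, (hφ1.contDiffOn.absolutelyContinuousOnInterval).integral_mul_deriv_eq_deriv_mul
    hp.contDiffOn.absolutelyContinuousOnInterval, h0, h1]
  ring

/-- A smooth function vanishing at both ends gives an element of `𝒱²`. -/
lemma exists_V2_of_contDiff (hℓ : 0 < ℓ) {p : ℝ → ℝ} (hp : ContDiff ℝ 2 p) (h0 : p 0 = 0)
    (h1 : p ℓ = 0) : ∃ v : V2 ℓ, fn (v : Jet ℓ) =ᵐ[volume.restrict (Ioo 0 ℓ)] p ∧
      ∀ a ∈ Icc 0 ℓ, value (d1 (v : Jet ℓ)) a = deriv p a := by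
  have hp1 : ContDiff ℝ 1 p := hp.of_le (by norm_num)
  have hp' : ContDiff ℝ 1 (deriv p) := (contDiff_succ_iff_deriv (n := 1).1 hp).2.2
  refine ⟨⟨(L2.ofContinuous ℓ p hp.continuous, L2.ofContinuous ℓ (deriv p) hp'.continuous,
    L2.ofContinuous ℓ (deriv (deriv p)) (hp'.continuous_deriv le_rfl)),
    ⟨L2.hasWeakDeriv_ofContinuous hℓ hp1, L2.hasWeakDeriv_ofContinuous hℓ hp'⟩, p,
    L2.isContRep_ofContinuous hp.continuous, h0, h1⟩,
    (L2.isContRep_ofContinuous (ℓ := ℓ) hp.continuous).2, fun a ha =>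
      (L2.isContRep_ofContinuous (ℓ := ℓ) hp'.continuous).value_eq hℓ ha⟩

lemma HasWeakDeriv.unique {f g g' : L2 ℓ} (h : HasWeakDeriv 0 ℓ f g)
    (h' : HasWeakDeriv 0 ℓ f g') : g = g' := by
  refine Lp.ext ?_
  rw [Filter.EventuallyEq, ae_restrict_iff' measurableSet_Ioo]
  have key : ∀ᵐ x, x ∈ Ioo 0 ℓ → g x - g' x = 0 := by
    refine isOpen_Ioo.ae_eq_zero_of_integral_contDiff_smul_eq_zero
      (IntegrableOn.locallyIntegrableOn ((L2.integrable g).sub (L2.integrable g')))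
      fun φ hφ hc hs => ?_
    have ht : IsTest (Ioo 0 ℓ) φ := ⟨hφ, hc, hs⟩
    have e : ∫ x, φ x • (g x - g' x) = ∫ x in Ioo 0 ℓ, φ x • (g x - g' x) := by
      symm
      refine setIntegral_eq_integral_of_forall_compl_eq_zero fun x hx => ?_
      rw [image_eq_zero_of_notMem_tsupport fun h' => hx (hs h'), zero_smul]
    rw [e]
    simp only [smul_sub]
    rw [integral_sub (ht.integrable_smul (L2.integrable g)) (ht.integrable_smul (L2.integrable g')),
      sub_eq_zero, ← neg_inj, ← h φ ht, h' φ ht]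
  filter_upwards [key] with x hx hm using sub_eq_zero.1 (hx hm)

/-- An element of `H²` is determined by its first entry. -/
lemma H2_ext {v w : Jet ℓ} (hv : v ∈ H2 ℓ) (hw : w ∈ H2 ℓ) (h : fn v = fn w) : v = w := by
  obtain ⟨a, b, c⟩ := v
  obtain ⟨a', b', c'⟩ := w
  obtain rfl : a = a' := h
  obtain rfl : b = b' := hv.1.unique hw.1
  obtain rfl : c = c' := hv.2.unique hw.2
  rfl

end Sobolev

/-! ### Weighted forms on `L²`, and special elements of `𝒱²` -/

section Weight

variable {ℓ : ℝ} {m : ℝ → ℝ}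

/-- Multiplication by an essentially bounded function on `L²(0, ℓ)`. -/
def weightMul (hm : MemLp m ⊤ (volume.restrict (Ioo 0 ℓ))) : L2 ℓ →L[ℝ] L2 ℓ :=
  (ContinuousLinearMap.mul ℝ ℝ).holderL (volume.restrict (Ioo 0 ℓ)) ⊤ 2 2 (hm.toLp m)

lemma coeFn_weightMul (hm : MemLp m ⊤ (volume.restrict (Ioo 0 ℓ))) (f : L2 ℓ) :
    weightMul hm f =ᵐ[volume.restrict (Ioo 0 ℓ)] fun x => m x * f x := by
  have h := (ContinuousLinearMap.mul ℝ ℝ).coeFn_holder (r := 2) (hm.toLp m) f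
  filter_upwards [h, hm.coeFn_toLp] with x h1 h2
  refine h1.trans ?_
  rw [h2]
  rfl

/-- The weighted inner product `∫ m f g`. -/
def weightForm (hm : MemLp m ⊤ (volume.restrict (Ioo 0 ℓ))) : L2 ℓ →L[ℝ] L2 ℓ →L[ℝ] ℝ :=
  (innerSL ℝ).comp (weightMul hm)

lemma weightForm_eq_inner (hm : MemLp m ⊤ (volume.restrict (Ioo 0 ℓ))) (f g : L2 ℓ) :
    weightForm hm f g = inner ℝ (weightMul hm f) g := rfl

lemma integrable_weight (hm : MemLp m ⊤ (volume.restrict (Ioo 0 ℓ))) (f g : L2 ℓ) :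
    Integrable (fun x => m x * f x * g x) (volume.restrict (Ioo 0 ℓ)) := by
  refine (L2.integrable_inner (𝕜 := ℝ) (weightMul hm f) g).congr ?_
  filter_upwards [coeFn_weightMul hm f] with x hx
  rw [hx]
  simp [mul_comm]

lemma weightForm_apply (hm : MemLp m ⊤ (volume.restrict (Ioo 0 ℓ))) (f g : L2 ℓ) :
    weightForm hm f g = ∫ x in Ioo 0 ℓ, m x * f x * g x := by
  rw [weightForm_eq_inner, L2.inner_def]
  refine integral_congr_ae ?_
  filter_upwards [coeFn_weightMul hm f] with x hx
  rw [hx]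
  simp [mul_comm]

lemma weightForm_symm (hm : MemLp m ⊤ (volume.restrict (Ioo 0 ℓ))) (f g : L2 ℓ) :
    weightForm hm f g = weightForm hm g f := by
  rw [weightForm_apply, weightForm_apply]
  congr 1; ext x; ring

lemma le_weightForm (hm : MemLp m ⊤ (volume.restrict (Ioo 0 ℓ))) {m₀ : ℝ}
    (h : ∀ᵐ x ∂(volume.restrict (Ioo 0 ℓ)), m₀ ≤ m x) (f : L2 ℓ) :
    m₀ * ‖f‖ ^ 2 ≤ weightForm hm f f := by
  rw [weightForm_apply, ← real_inner_self_eq_norm_sq, L2.inner_def, ← integral_const_mul]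
  refine integral_mono_ae ((L2.integrable_inner (𝕜 := ℝ) f f).const_mul m₀)
    (integrable_weight hm f f) ?_
  filter_upwards [h] with x hx
  simp only [RCLike.inner_apply, conj_trivial, mul_assoc]
  exact mul_le_mul_of_nonneg_right hx (mul_self_nonneg _)

/-- The functions in `𝒱²` separate the points of `L²`. -/
lemma eq_zero_of_forall_inner_V2 (hℓ : 0 < ℓ) {f : L2 ℓ}
    (h : ∀ v : V2 ℓ, inner ℝ f (fn (v : Jet ℓ)) = 0) : f = 0 := by
  refine Lp.ext ?_
  have key : ∀ᵐ x, x ∈ Ioo 0 ℓ → f x = 0 := by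
    refine isOpen_Ioo.ae_eq_zero_of_integral_contDiff_smul_eq_zero
      (IntegrableOn.locallyIntegrableOn (L2.integrable f)) fun φ hφ hc hs => ?_
    have hz : ∀ x, x ∉ Ioo 0 ℓ → φ x = 0 := fun x hx =>
      image_eq_zero_of_notMem_tsupport fun h' => hx (hs h')
    -- A test function on `(0, ℓ)` vanishes at both ends and so defines an element of `𝒱²`.
    obtain ⟨v, hv, -⟩ := exists_V2_of_contDiff hℓ (contDiff_infty.1 hφ 2)
      (hz 0 fun h' => lt_irrefl _ h'.1) (hz ℓ fun h' => lt_irrefl _ h'.2)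
    have e : ∫ x, φ x • f x = ∫ x in Ioo 0 ℓ, φ x • f x := by
      symm
      refine setIntegral_eq_integral_of_forall_compl_eq_zero fun x hx => ?_
      rw [hz x hx, zero_smul]
    rw [e]
    refine Eq.trans ?_ (h v)
    rw [L2.inner_def]
    refine integral_congr_ae ?_
    filter_upwards [hv] with x hx
    rw [hx]
    simp
  rw [Filter.EventuallyEq, ae_restrict_iff' measurableSet_Ioo]
  have h0 := Lp.coeFn_zero ℝ 2 (volume.restrict (Ioo 0 ℓ))
  rw [Filter.EventuallyEq, ae_restrict_iff' measurableSet_Ioo] at h0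
  filter_upwards [key, h0] with x hx hx0 hm
  rw [hx hm, hx0 hm]
  rfl

/-- Elements of `𝒱²` with prescribed slopes `1, 0` and `0, 1` at the ends. -/
lemma exists_V2_slopes (hℓ : 0 < ℓ) : ∃ z : Fin 2 → V2 ℓ,
    endSlope ℓ 1 (z 0) = 1 ∧ endSlope ℓ 0 (z 0) = 0 ∧
      endSlope ℓ 1 (z 1) = 0 ∧ endSlope ℓ 0 (z 1) = 1 := by
  have hd : ∀ p q : ℝ, ∀ x, deriv (fun x : ℝ => x * (x - ℓ) * (p * x + q)) x
      = (2 * x - ℓ) * (p * x + q) + x * (x - ℓ) * p := by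
    intro p q x
    have h1 : HasDerivAt (fun x : ℝ => x * (x - ℓ) * (p * x + q))
        ((1 * (x - ℓ) + x * 1) * (p * x + q) + x * (x - ℓ) * (p * 1)) x :=
      (((hasDerivAt_id x).mul ((hasDerivAt_id x).sub_const ℓ)).mul
        (((hasDerivAt_id x).const_mul p).add_const q))
    rw [h1.deriv]
    ring
  have hne := hℓ.ne'
  have hex : ∀ p q : ℝ, ∃ v : V2 ℓ, endSlope ℓ 1 v = -ℓ * q ∧ endSlope ℓ 0 v = ℓ * (p * ℓ + q) := by
    intro p q
    obtain ⟨v, -, hv⟩ := exists_V2_of_contDiff hℓ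
      (p := fun x : ℝ => x * (x - ℓ) * (p * x + q)) (by fun_prop) (by simp) (by simp)
    refine ⟨v, ?_, ?_⟩
    · rw [endSlope_one hℓ, hv 0 (left_mem_Icc.2 hℓ.le), hd]
      ring
    · rw [endSlope_zero hℓ, hv ℓ (right_mem_Icc.2 hℓ.le), hd]
      ring
  -- The cubic with parameters `p`, `q` has end slopes `-ℓ q` and `ℓ (p ℓ + q)`; the parameters
  -- solve for `(1, 0)` here and for `(0, 1)` below.
  obtain ⟨z₀, a₀, b₀⟩ := hex (1 / ℓ ^ 2) (-(1 / ℓ))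
  obtain ⟨z₁, a₁, b₁⟩ := hex (1 / ℓ ^ 2) 0
  refine ⟨![z₀, z₁], ?_, ?_, ?_, ?_⟩
  · refine a₀.trans ?_
    field_simp
  · refine b₀.trans ?_
    field_simp
    ring
  · refine a₁.trans ?_
    ring
  · refine b₁.trans ?_
    field_simp
    ring

end Weight

/-! ### The beam as an abstract damped wave -/

/-- The abstract damped wave equation of a beam. -/
def Beam.wave (B : Beam) (hB : B.Basic) : DampedWave (V2 B.ℓ) (L2 B.ℓ) where
  i := (ContinuousLinearMap.fst ℝ (L2 B.ℓ) (L2 B.ℓ × L2 B.ℓ)).comp (V2 B.ℓ).subtypeL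
  M := weightForm hB.m_Linfty
  N := weightForm hB.μ_Linfty
  a := (weightForm hB.r_Linfty).bilinearComp
        ((ContinuousLinearMap.snd ℝ (L2 B.ℓ) (L2 B.ℓ)).comp
          ((ContinuousLinearMap.snd ℝ (L2 B.ℓ) (L2 B.ℓ × L2 B.ℓ)).comp (V2 B.ℓ).subtypeL))
        ((ContinuousLinearMap.snd ℝ (L2 B.ℓ) (L2 B.ℓ)).comp
          ((ContinuousLinearMap.snd ℝ (L2 B.ℓ) (L2 B.ℓ × L2 B.ℓ)).comp (V2 B.ℓ).subtypeL))
      + B.krL • (ContinuousLinearMap.mul ℝ ℝ).bilinearComp (endSlope B.ℓ 1) (endSlope B.ℓ 1)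
      + B.krR • (ContinuousLinearMap.mul ℝ ℝ).bilinearComp (endSlope B.ℓ 0) (endSlope B.ℓ 0)
  b := ![endSlope B.ℓ 1, endSlope B.ℓ 0]
  k := ![B.kaL, B.kaR]

namespace Beam

variable {B : Beam} (hB : B.Basic)

lemma wave_i (v : V2 B.ℓ) : (B.wave hB).i v = fn (v : Jet B.ℓ) := rfl

lemma wave_M (y z : L2 B.ℓ) : (B.wave hB).M y z = ∫ x in Ioo 0 B.ℓ, B.m x * y x * z x :=
  weightForm_apply _ _ _

lemma wave_N (y z : L2 B.ℓ) : (B.wave hB).N y z = ∫ x in Ioo 0 B.ℓ, B.μ x * y x * z x :=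
  weightForm_apply _ _ _

lemma wave_a_eq (u v : V2 B.ℓ) : (B.wave hB).a u v
    = weightForm hB.r_Linfty (d2 (u : Jet B.ℓ)) (d2 (v : Jet B.ℓ))
      + B.krL * (endSlope B.ℓ 1 u * endSlope B.ℓ 1 v)
      + B.krR * (endSlope B.ℓ 0 u * endSlope B.ℓ 0 v) := rfl

lemma wave_a (u v : V2 B.ℓ) : (B.wave hB).a u v
    = (∫ x in Ioo 0 B.ℓ, B.r x * d2 (u : Jet B.ℓ) x * d2 (v : Jet B.ℓ) x)
      + B.krL * value (d1 (u : Jet B.ℓ)) 0 * value (d1 (v : Jet B.ℓ)) 0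
      + B.krR * value (d1 (u : Jet B.ℓ)) B.ℓ * value (d1 (v : Jet B.ℓ)) B.ℓ := by
  rw [wave_a_eq, weightForm_apply]
  simp only [endSlope_one hB.ℓ_pos, endSlope_zero hB.ℓ_pos]
  ring

lemma wave_b_zero (v : V2 B.ℓ) : (B.wave hB).b 0 v = value (d1 (v : Jet B.ℓ)) 0 :=
  endSlope_one hB.ℓ_pos v

lemma wave_b_one (v : V2 B.ℓ) : (B.wave hB).b 1 v = value (d1 (v : Jet B.ℓ)) B.ℓ :=
  endSlope_zero hB.ℓ_pos v

lemma wave_k_zero : (B.wave hB).k 0 = B.kaL := rfl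

lemma wave_k_one : (B.wave hB).k 1 = B.kaR := rfl

/-- The lower bound on `m` controls the velocity. The lower bound on `r` controls `‖v''‖`, hence the
full norm of `𝒱²`; the springs only add nonnegative terms. -/
lemma exists_coercive : ∃ c, (B.wave hB).Coercive c := by
  obtain ⟨m₀, hm₀, hm⟩ := hB.m_bound
  obtain ⟨r₀, hr₀, hr⟩ := hB.r_bound
  obtain ⟨C, hC, hCv⟩ := exists_norm_le_d2 hB.ℓ_pos
  refine ⟨min m₀ (r₀ / C ^ 2), lt_min hm₀ (by positivity), fun x y => weightForm_symm _ x y,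
    fun x y => ?_, fun x => ?_, fun v => ?_⟩
  · rw [wave_a_eq, wave_a_eq, weightForm_symm]
    ring
  · refine le_trans ?_ (le_weightForm hB.m_Linfty hm x)
    gcongr
    exact min_le_left _ _
  · rw [wave_a_eq]
    have h1 := le_weightForm hB.r_Linfty hr (d2 (v : Jet B.ℓ))
    have h2 : 0 ≤ B.krL * (endSlope B.ℓ 1 v * endSlope B.ℓ 1 v) :=
      mul_nonneg hB.krL_nonneg (mul_self_nonneg _)
    have h3 : 0 ≤ B.krR * (endSlope B.ℓ 0 v * endSlope B.ℓ 0 v) :=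
      mul_nonneg hB.krR_nonneg (mul_self_nonneg _)
    have h4 : min m₀ (r₀ / C ^ 2) * ‖v‖ ^ 2 ≤ r₀ * ‖d2 (v : Jet B.ℓ)‖ ^ 2 := by
      calc min m₀ (r₀ / C ^ 2) * ‖v‖ ^ 2 ≤ r₀ / C ^ 2 * (C * ‖d2 (v : Jet B.ℓ)‖) ^ 2 := by
            gcongr
            · exact min_le_right _ _
            · exact hCv v
        _ = r₀ * ‖d2 (v : Jet B.ℓ)‖ ^ 2 := by field_simp
    linarith

lemma energyForm_wave (v : V2 B.ℓ) (z : L2 B.ℓ) :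
    (B.wave hB).energyForm (v, z, 0) (v, z, 0) = energy B (v : Jet B.ℓ) z := by
  rw [DampedWave.energyForm_apply, energy, wave_M, wave_a]
  have h1 : ∫ x in Ioo 0 B.ℓ, (B.m x * (z x) ^ 2 + B.r x * (d2 (v : Jet B.ℓ) x) ^ 2)
      = (∫ x in Ioo 0 B.ℓ, B.m x * z x * z x)
        + ∫ x in Ioo 0 B.ℓ, B.r x * d2 (v : Jet B.ℓ) x * d2 (v : Jet B.ℓ) x := by
    rw [← integral_add (integrable_weight hB.m_Linfty z z) (integrable_weight hB.r_Linfty _ _)]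
    congr 1; ext x; ring
  rw [h1]
  ring

end Beam

lemma memLp_clm_apply {X α : Type*} [MeasurableSpace α] {μ : Measure α} [NormedAddCommGroup X]
    [NormedSpace ℝ X] {w : α → X →L[ℝ] ℝ} (hw : MemLp w 2 μ) (z : X) :
    MemLp (fun t => w t z) 2 μ :=
  (ContinuousLinearMap.apply ℝ ℝ z).comp_memLp' hw

lemma memLp_bilin_apply {X Y α : Type*} [MeasurableSpace α] {μ : Measure α}
    [NormedAddCommGroup X] [NormedSpace ℝ X] [NormedAddCommGroup Y] [NormedSpace ℝ Y]
    {f : α → X} (hf : MemLp f 2 μ) (D : X →L[ℝ] Y →L[ℝ] ℝ) (z : Y) :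
    MemLp (fun t => D (f t) z) 2 μ :=
  (D.flip z).comp_memLp' hf

/-! ### From the weak formulation of the beam to the abstract one; initial data -/

namespace IsWeakSolution

variable {B : Beam} {u₀ : H2 B.ℓ} {u₁ : L2 B.ℓ} {u : ℝ → V2 B.ℓ} {ut : ℝ → L2 B.ℓ}
  {w : ℝ → (V2 B.ℓ →L[ℝ] ℝ)}

/-- The right hand side which is the distributional time derivative of the damping moments. -/
def load (hB : B.Basic) (u : ℝ → V2 B.ℓ) (ut : ℝ → L2 B.ℓ) (w : ℝ → (V2 B.ℓ →L[ℝ] ℝ))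
    (z : V2 B.ℓ) (t : ℝ) : ℝ :=
  w t z + (B.wave hB).N (ut t) ((B.wave hB).i z) + (B.wave hB).a (u t) z

lemma memLp_load (hB : B.Basic) (hu : IsWeakSolution B u₀ u₁ u ut w) (z : V2 B.ℓ) :
    MemLp (load hB u ut w z) 2 (volume.restrict (Ioo 0 B.T)) :=
  ((memLp_clm_apply hu.memLp_w z).add
    (memLp_bilin_apply hu.memLp_ut (B.wave hB).N ((B.wave hB).i z))).add
    (memLp_bilin_apply hu.memLp_u (B.wave hB).a z)

lemma integral_load (hB : B.Basic) (hu : IsWeakSolution B u₀ u₁ u ut w) (z : V2 B.ℓ)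
    {φ : ℝ → ℝ} (hφ : IsTest (Ioo 0 B.T) φ) :
    ∫ t in Ioo 0 B.T, φ t * load hB u ut w z t
      = ∑ j, (B.wave hB).k j * (∫ t in Ioo 0 B.T, deriv φ t * (B.wave hB).b j (u t))
          * (B.wave hB).b j z := by
  have h1 := hu.equation z φ hφ
  have hb : ∀ j, Integrable (fun t => deriv φ t * (B.wave hB).b j (u t))
      (volume.restrict (Ioo 0 B.T)) := fun j =>
    hφ.integrable_deriv_smul ((((B.wave hB).b j).comp_memLp' hu.memLp_u).integrable (by norm_num))
  have e1 : ∀ t, φ t * load hB u ut w z t = φ t * (w t z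
          + (∫ x in Ioo 0 B.ℓ, B.μ x * ut t x * fn (z : Jet B.ℓ) x)
          + (∫ x in Ioo 0 B.ℓ, B.r x * d2 (u t : Jet B.ℓ) x * d2 (z : Jet B.ℓ) x)
          + B.krL * value (d1 (u t : Jet B.ℓ)) 0 * value (d1 (z : Jet B.ℓ)) 0
          + B.krR * value (d1 (u t : Jet B.ℓ)) B.ℓ * value (d1 (z : Jet B.ℓ)) B.ℓ) := by
    intro t
    rw [load, Beam.wave_N, Beam.wave_a, Beam.wave_i]
    ring
  have e2 : ∫ t in Ioo 0 B.T, deriv φ t *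
        (B.kaL * value (d1 (u t : Jet B.ℓ)) 0 * value (d1 (z : Jet B.ℓ)) 0
          + B.kaR * value (d1 (u t : Jet B.ℓ)) B.ℓ * value (d1 (z : Jet B.ℓ)) B.ℓ)
      = ∑ j, (B.wave hB).k j * (∫ t in Ioo 0 B.T, deriv φ t * (B.wave hB).b j (u t))
          * (B.wave hB).b j z := by
    rw [Fin.sum_univ_two, ← integral_const_mul, ← integral_const_mul, ← integral_mul_const,
      ← integral_mul_const, ← integral_add (((hb 0).const_mul _).mul_const _)
        (((hb 1).const_mul _).mul_const _)]
    refine integral_congr_ae (Eventually.of_forall fun t => ?_)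
    simp only [Beam.wave_b_zero, Beam.wave_b_one, Beam.wave_k_zero, Beam.wave_k_one]
    ring
  simp only [e1]
  rw [← e2]
  exact sub_eq_zero.1 h1

/-- The time derivatives of the slopes at the ends with a damper. -/
def slopeRate (hB : B.Basic) (u : ℝ → V2 B.ℓ) (ut : ℝ → L2 B.ℓ) (w : ℝ → (V2 B.ℓ →L[ℝ] ℝ))
    (z : Fin 2 → V2 B.ℓ) (t : ℝ) (j : Fin 2) : ℝ :=
  -- The load of `z j` is minus the derivative of the `j`-th damping moment. Since `0⁻¹ = 0`, the
  -- rate is `0` at an end without damper.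
  -((B.wave hB).k j)⁻¹ * load hB u ut w (z j) t

/-- The dual elements `z j` produce the slope rates in `L²(0, T)`. Test functions supported in `(0,
T)` vanish at `0`, so the initial data drop out, and eliminating `w` between the equation and
`deriv_ut` gives the abstract equation. -/
lemma weakSolution (hB : B.Basic) (hu : IsWeakSolution B u₀ u₁ u ut w) {z : Fin 2 → V2 B.ℓ}
    (hz : ∀ i j, (B.wave hB).b i (z j) = if i = j then 1 else 0) :
    (B.wave hB).WeakSolution B.T u ut (slopeRate hB u ut w z) where
  memLp_u := hu.memLp_u
  memLp_ut := hu.memLp_ut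
  memLp_θ := memLp_pi_iff.2 fun j => (memLp_load hB hu (z j)).const_mul _
  velocity φ hφ := by
    have h1 := hu.deriv_u φ (hφ.mono fun _ hx => hx.2)
    have h0 : φ 0 = 0 := image_eq_zero_of_notMem_tsupport fun h' => lt_irrefl _ (hφ.supp h').1
    rw [h0, zero_smul, sub_zero] at h1
    exact h1
  damper j φ hφ := by
    -- Testing with `z j` leaves only the `j`-th damper in the sum.
    have h1 := integral_load hB hu (z j) hφ
    simp only [hz, mul_ite, mul_one, mul_zero, Finset.sum_ite_eq', Finset.mem_univ, if_true] at h1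
    rw [← h1]
    have h2 : ∀ t, φ t * slopeRate hB u ut w z t j
        = -((B.wave hB).k j)⁻¹ * (φ t * load hB u ut w (z j) t) := fun t => by
      rw [slopeRate]; ring
    simp only [h2]
    rw [integral_const_mul, h1]
    rcases eq_or_ne ((B.wave hB).k j) 0 with h | h
    · simp [h]
    · field_simp
  equation v φ hφ := by
    have h1 := integral_load hB hu v hφ
    have h2 := hu.deriv_ut v φ (hφ.mono fun _ hx => hx.2)
    have h0 : φ 0 = 0 := image_eq_zero_of_notMem_tsupport fun h' => lt_irrefl _ (hφ.supp h').1
    rw [h0, zero_mul, sub_zero] at h2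
    have h3 : ∫ t in Ioo 0 B.T, deriv φ t * (B.wave hB).M (ut t) ((B.wave hB).i v)
        = -∫ t in Ioo 0 B.T, φ t * w t v := by
      simp only [Beam.wave_M, Beam.wave_i]
      exact h2
    have i1 : Integrable (fun t => φ t * w t v) (volume.restrict (Ioo 0 B.T)) :=
      hφ.integrable_smul
        ((memLp_clm_apply hu.memLp_w v).integrable (by norm_num))
    have i2 : Integrable (fun t => φ t * (B.wave hB).N (ut t) ((B.wave hB).i v))
        (volume.restrict (Ioo 0 B.T)) := hφ.integrable_smul
      ((memLp_bilin_apply hu.memLp_ut (B.wave hB).N ((B.wave hB).i v)).integrable (by norm_num))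
    have i3 : Integrable (fun t => φ t * (B.wave hB).a (u t) v)
        (volume.restrict (Ioo 0 B.T)) := hφ.integrable_smul
      ((memLp_bilin_apply hu.memLp_u (B.wave hB).a v).integrable (by norm_num))
    have h4 : ∫ t in Ioo 0 B.T, φ t * load hB u ut w v t = (∫ t in Ioo 0 B.T, φ t * w t v)
        + (∫ t in Ioo 0 B.T, φ t * (B.wave hB).N (ut t) ((B.wave hB).i v))
        + ∫ t in Ioo 0 B.T, φ t * (B.wave hB).a (u t) v := by
      simp only [load, mul_add]
      have i12 : Integrable (fun t => φ t * w t v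
          + φ t * (B.wave hB).N (ut t) ((B.wave hB).i v)) (volume.restrict (Ioo 0 B.T)) :=
        i1.add i2
      rw [integral_add i12 i3, integral_add i1 i2]
    rw [h3, neg_neg, ← h4, h1, sub_self]

/-- The integration by parts in time determines only the first entry at `t = 0`; uniqueness of weak
derivatives recovers the whole triple. -/
lemma initial_position (hB : B.Basic) (hu : IsWeakSolution B u₀ u₁ u ut w) {U : ℝ → V2 B.ℓ}
    (hU : ContinuousOn U (Icc 0 B.T)) (hae : ∀ᵐ t ∂(volume.restrict (Ioo 0 B.T)), U t = u t) :
    (U 0 : Jet B.ℓ) = u₀ := by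
  refine H2_ext (U 0).2.1 u₀.2 ?_
  have hc : ContinuousOn (fun t => fn (U t : Jet B.ℓ)) (Icc 0 B.T) :=
    (continuous_fst.comp continuous_subtype_val).comp_continuousOn hU
  refine eq_initial_value (g := fun t => fn (U t : Jet B.ℓ)) hB.T_pos hc
    (hu.memLp_ut.integrable (by norm_num)) fun φ hφ => ?_
  rw [← hu.deriv_u φ hφ]
  refine integral_congr_ae ?_
  filter_upwards [hae] with t ht
  rw [ht]

/-- Since `w` takes values in the dual of `𝒱²`, the initial value is found against each `v`
separately. Then `m (U' 0 - u₁)` is orthogonal to `𝒱²`, hence zero, and coercivity of the mass form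
removes `m`. -/
lemma initial_velocity (hB : B.Basic) (hu : IsWeakSolution B u₀ u₁ u ut w) {U' : ℝ → L2 B.ℓ}
    (hU' : ContinuousOn U' (Icc 0 B.T))
    (hae : ∀ᵐ t ∂(volume.restrict (Ioo 0 B.T)), U' t = ut t) : U' 0 = u₁ := by
  obtain ⟨c, hc⟩ := Beam.exists_coercive hB
  have h1 : ∀ v : V2 B.ℓ, weightForm hB.m_Linfty (U' 0) (fn (v : Jet B.ℓ))
      = weightForm hB.m_Linfty u₁ (fn (v : Jet B.ℓ)) := by
    intro v
    have hcont : ContinuousOn (fun t => weightForm hB.m_Linfty (U' t) (fn (v : Jet B.ℓ)))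
        (Icc 0 B.T) :=
      ((weightForm hB.m_Linfty).flip (fn (v : Jet B.ℓ))).continuous.comp_continuousOn hU'
    refine eq_initial_value (g := fun t => weightForm hB.m_Linfty (U' t) (fn (v : Jet B.ℓ)))
      (q := fun t => w t v) hB.T_pos hcont
      ((memLp_clm_apply hu.memLp_w v).integrable (by norm_num))
      fun φ hφ => ?_
    simp only [smul_eq_mul]
    rw [weightForm_apply hB.m_Linfty u₁, ← hu.deriv_ut v φ hφ]
    refine integral_congr_ae ?_
    filter_upwards [hae] with t ht
    rw [ht, weightForm_apply]
  have h2 : weightMul hB.m_Linfty (U' 0 - u₁) = 0 := by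
    refine eq_zero_of_forall_inner_V2 hB.ℓ_pos fun v => ?_
    rw [← weightForm_eq_inner, map_sub, sub_apply, h1, sub_self]
  have h3 : weightForm hB.m_Linfty (U' 0 - u₁) (U' 0 - u₁) = 0 := by
    rw [weightForm_eq_inner, h2, inner_zero_left]
  have h4 := hc.M_le (U' 0 - u₁)
  have h5 : (B.wave hB).M (U' 0 - u₁) (U' 0 - u₁) = 0 := h3
  rw [h5] at h4
  have h6 : ‖U' 0 - u₁‖ ^ 2 = 0 := by
    have := hc.pos
    have : 0 ≤ ‖U' 0 - u₁‖ ^ 2 := by positivity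
    nlinarith
  exact sub_eq_zero.1 (norm_eq_zero.1 (pow_eq_zero_iff two_ne_zero |>.1 h6))

end IsWeakSolution

lemma Beam.dissipation_nonneg {B : Beam} (hB : B.Basic) (x : State (V2 B.ℓ) (L2 B.ℓ)) :
    0 ≤ (B.wave hB).dissipation x x := by
  have h1 := le_weightForm hB.μ_Linfty hB.μ_nonneg x.2.1
  rw [zero_mul] at h1
  rw [DampedWave.dissipation_apply, Fin.sum_univ_two]
  have h2 := mul_nonneg hB.kaL_nonneg (mul_self_nonneg (x.2.2 0))
  have h3 := mul_nonneg hB.kaR_nonneg (mul_self_nonneg (x.2.2 1))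
  exact add_nonneg h1 (add_nonneg h2 h3)

end BeamEnergy
end

/-! ### The energy identity for the beam -/

theorem theorem1 (B : BeamEnergy.Beam) (hB : B.Basic)
    (u₀ : BeamEnergy.H2 B.ℓ) (u₁ : BeamEnergy.L2 B.ℓ)
    (u : ℝ → BeamEnergy.V2 B.ℓ) (ut : ℝ → BeamEnergy.L2 B.ℓ)
    (w : ℝ → (BeamEnergy.V2 B.ℓ →L[ℝ] ℝ))
    (hu : BeamEnergy.IsWeakSolution B u₀ u₁ u ut w) :
    -- `U`, `U'` are the continuous representatives of `u`, `u_t`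
    ∃ (U : ℝ → BeamEnergy.V2 B.ℓ) (U' : ℝ → BeamEnergy.L2 B.ℓ) (θ₀ θ₁ : ℝ → ℝ),
      (∀ᵐ t ∂(volume.restrict (Ioo 0 B.T)), U t = u t ∧ U' t = ut t) ∧
      ContinuousOn U (Icc 0 B.T) ∧
      ContinuousOn U' (Icc 0 B.T) ∧
      (∀ t ∈ Icc 0 B.T, HasDerivWithinAt
        (fun s => BeamEnergy.fn (U s : BeamEnergy.Jet B.ℓ)) (U' t) (Icc 0 B.T) t) ∧
      (U 0 : BeamEnergy.Jet B.ℓ) = u₀ ∧ U' 0 = u₁ ∧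
      -- `θ₀ = u_xt(0, ·)` and `θ₁ = u_xt(ℓ, ·)` exist in `L²(0, T)` at an end with a damper
      (0 < B.kaL → MemLp θ₀ 2 (volume.restrict (Ioo 0 B.T)) ∧
        BeamEnergy.HasWeakDeriv 0 B.T
          (fun t => BeamEnergy.value (BeamEnergy.d1 (U t : BeamEnergy.Jet B.ℓ)) 0) θ₀) ∧
      (0 < B.kaR → MemLp θ₁ 2 (volume.restrict (Ioo 0 B.T)) ∧
        BeamEnergy.HasWeakDeriv 0 B.T
          (fun t => BeamEnergy.value (BeamEnergy.d1 (U t : BeamEnergy.Jet B.ℓ)) B.ℓ) θ₁) ∧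
      -- the energy identity
      (∀ t ∈ Icc 0 B.T,
        BeamEnergy.energy B (U t) (U' t)
            + ∫ s in Ioo 0 t, ∫ x in Ioo 0 B.ℓ, B.μ x * (U' s x) ^ 2
          = BeamEnergy.energy B u₀ u₁
            - B.kaL * (∫ s in Ioo 0 t, (θ₀ s) ^ 2) - B.kaR * (∫ s in Ioo 0 t, (θ₁ s) ^ 2)) ∧
      -- the energy is nonincreasing
      AntitoneOn (fun t => BeamEnergy.energy B (U t) (U' t)) (Icc 0 B.T) ∧
      (∀ t ∈ Icc 0 B.T, BeamEnergy.energy B (U t) (U' t) ≤ BeamEnergy.energy B u₀ u₁) := by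
  have hcV : CompleteSpace (BeamEnergy.V2 B.ℓ) := BeamEnergy.completeSpace_V2 hB.ℓ_pos
  obtain ⟨c, hc⟩ := BeamEnergy.Beam.exists_coercive hB
  obtain ⟨z, z00, z10, z01, z11⟩ := BeamEnergy.exists_V2_slopes hB.ℓ_pos
  have hz : ∀ i j, (B.wave hB).b i (z j) = if i = j then 1 else 0 := by
    intro i j
    fin_cases i <;> fin_cases j
    exacts [z00, z01, z10, z11]
  have hW := hu.weakSolution hB hz
  set θ := BeamEnergy.IsWeakSolution.slopeRate hB u ut w z with hθ
  obtain ⟨U, U', hU, hU', hae, hder, hen⟩ := hW.exists_continuous hc hB.T_pos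
  have hU0 : (U 0 : BeamEnergy.Jet B.ℓ) = u₀ :=
    hu.initial_position hB hU (hae.mono fun _ h => h.1)
  have hU'0 : U' 0 = u₁ := hu.initial_velocity hB hU' (hae.mono fun _ h => h.2)
  have hθm : ∀ j, MemLp (fun t => θ t j) 2 (volume.restrict (Ioo 0 B.T)) :=
    memLp_pi_iff.1 hW.memLp_θ
  -- The abstract identity carries the factor `k j`, which can be cancelled exactly at an end with a
  -- damper; `u` and `U` agree almost everywhere.
  have hweak : ∀ j, 0 < (B.wave hB).k j →
      BeamEnergy.HasWeakDeriv 0 B.T (fun t => (B.wave hB).b j (U t)) fun t => θ t j := by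
    intro j hj φ hφ
    have h1 := hW.damper j φ hφ
    rw [← mul_neg] at h1
    refine Eq.trans ?_ (mul_left_cancel₀ hj.ne' h1)
    refine integral_congr_ae ?_
    filter_upwards [hae] with t ht
    rw [ht.1, smul_eq_mul]
  have hD : IntegrableOn (fun s => (B.wave hB).dissipation (u s, ut s, θ s) (u s, ut s, θ s))
      (Ioo 0 B.T) :=
    BeamEnergy.MemLp.integrable_bilin (B.wave hB).dissipation hW.memLp_state hW.memLp_state
  have hDsum : ∀ t ∈ Icc 0 B.T,
      ∫ s in Ioo 0 t, (B.wave hB).dissipation (u s, ut s, θ s) (u s, ut s, θ s)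
        = (∫ s in Ioo 0 t, ∫ x in Ioo 0 B.ℓ, B.μ x * (U' s x) ^ 2)
          + (B.kaL * (∫ s in Ioo 0 t, (θ s 0) ^ 2) + B.kaR * ∫ s in Ioo 0 t, (θ s 1) ^ 2) := by
    intro t ht
    have hsub : Ioo 0 t ⊆ Ioo 0 B.T := Ioo_subset_Ioo_right ht.2
    have i0 : ∀ j, IntegrableOn (fun s => (θ s j) ^ 2) (Ioo 0 t) := fun j =>
      IntegrableOn.mono_set (hθm j).integrable_sq hsub
    have i1 : IntegrableOn (fun s => (B.wave hB).N (ut s) (ut s)) (Ioo 0 t) :=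
      IntegrableOn.mono_set
        (BeamEnergy.MemLp.integrable_bilin (B.wave hB).N hW.memLp_ut hW.memLp_ut) hsub
    have e1 : ∫ s in Ioo 0 t, ∫ x in Ioo 0 B.ℓ, B.μ x * (U' s x) ^ 2
        = ∫ s in Ioo 0 t, (B.wave hB).N (ut s) (ut s) := by
      refine integral_congr_ae ?_
      filter_upwards [ae_restrict_of_ae_restrict_of_subset hsub hae] with s hs
      rw [hs.2, BeamEnergy.Beam.wave_N]
      simp only [pow_two, mul_assoc]
    have i2 : IntegrableOn (fun s => B.kaL * (θ s 0) ^ 2 + B.kaR * (θ s 1) ^ 2) (Ioo 0 t) :=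
      ((i0 0).const_mul _).add ((i0 1).const_mul _)
    rw [e1, ← integral_const_mul, ← integral_const_mul,
      ← integral_add ((i0 0).const_mul _) ((i0 1).const_mul _), ← integral_add i1 i2]
    refine integral_congr_ae (Eventually.of_forall fun s => ?_)
    simp only [BeamEnergy.DampedWave.dissipation_apply, Fin.sum_univ_two,
      BeamEnergy.Beam.wave_k_zero, BeamEnergy.Beam.wave_k_one, pow_two]
  simp only [BeamEnergy.Beam.energyForm_wave, hU0, hU'0] at hen
  -- The energy is its initial value minus the dissipation up to `t`, the integral of a nonnegative
  -- function over a growing interval.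
  have hanti : AntitoneOn (fun t => BeamEnergy.energy B (U t) (U' t)) (Icc 0 B.T) := by
    intro s hs t ht hst
    have h1 := hen s hs
    have h2 := hen t ht
    have h3 : ∫ τ in Ioo 0 s, (B.wave hB).dissipation (u τ, ut τ, θ τ) (u τ, ut τ, θ τ)
        ≤ ∫ τ in Ioo 0 t, (B.wave hB).dissipation (u τ, ut τ, θ τ) (u τ, ut τ, θ τ) :=
      setIntegral_mono_set (hD.mono_set (Ioo_subset_Ioo_right ht.2))
        (Eventually.of_forall fun τ => BeamEnergy.Beam.dissipation_nonneg hB _)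
        (Ioo_subset_Ioo_right hst).eventuallyLE
    simp only
    linarith
  refine ⟨U, U', fun t => θ t 0, fun t => θ t 1, hae, hU, hU', hder, hU0, hU'0,
    fun hk => ⟨hθm 0, ?_⟩, fun hk => ⟨hθm 1, ?_⟩, fun t ht => ?_, hanti, fun t ht => ?_⟩
  · simpa only [BeamEnergy.Beam.wave_b_zero] using hweak 0 hk
  · simpa only [BeamEnergy.Beam.wave_b_one] using hweak 1 hk
  · have h1 := hen t ht
    rw [hDsum t ht] at h1
    linarith
  · have h1 := hanti (left_mem_Icc.2 hB.T_pos.le) ht ht.1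
    simpa only [hU0, hU'0] using h1
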